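/- Let $\mathbb{H}^2$ be the hyperbolic plane with geodesic polar coordinates $(r,\theta)$, metric $dr^2+\sinh^2 r\,d\theta^2$ and area element $\mathrm{dvol}=\sinh r\,dr\,d\theta$, and let $\mathbb{S}^2\subset\mathbb{R}^3$ be the unit sphere, $\vec k=(0,0,1)$. For a map $u:\mathbb{H}^2\to\mathbb{S}^2$ put $$\|u\|_{\mathfrak{H}^3}^2=\sum_{i=1}^3\int_{\mathbb{H}^2}|\nabla^{i-1}du|^2\,\mathrm{dvol},$$ where $\nabla$ is the induced connection on $T^*\mathbb{H}^2\otimes\cdots\otimes T^*\mathbb{H}^2\otimes u^*T\mathbb{S}^2$, and for a function $f:\mathbb{H}^2\to\mathbb{C}$ put $\|f\|_{H^2}^2=\sum_{l\le 2}\int_{\mathbb{H}^2}|\nabla^l f|^2\,\mathrm{dvol}$, with $\nabla^l f$ the $l$-th covariant derivative (derivatives are weak; each norm is $\infty$ when they do not exist). Let $u$ be $1$-equivariant, that is $u\circ\rho=\rho\circ u$ for all rotations $\rho$, so that $u(r,\theta)=e^{\theta R}\bar u(r)$ with $Rx=\vec k\times x$, and let $u\in\mathcal{E}_0$: the energy $\frac12\int|du|^2\,\mathrm{dvol}$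 is finite, and $u_3\to1$ both as $r\to0$ and as $r\to\infty$. Let $v=e^{\theta R}\bar v(r)$, $w=u\times v$ be the Coulomb frame along $u$: $\bar v$ is locally absolutely continuous on $(0,\infty)$, $|\bar v|=1$, $\bar v\cdot\bar u=0$, $\partial_r\bar v=-(\bar v\cdot\partial_r\bar u)\,\bar u$ almost everywhere, and $\bar v\to(1,0,0)$, $\bar w=\bar u\times\bar v\to(0,1,0)$ as $r\to\infty$. Put $$\psi_1=\partial_r u\cdot v+i\,\partial_r u\cdot w,\quad \psi_2=\partial_\theta u\cdot v+i\,\partial_\theta u\cdot w,\quad \psi^{\pm}=\psi_1\pm i\frac{\psi_2}{\sinh r},\quad R_+\psi^+=e^{2i\theta}\psi^+,\quad R_-\psi^-=\psi^- .$$ Then $\|u\|_{\mathfrak{H}^3}\sim\|R_+\psi^+\|_{H^2}+\|R_-\psi^-\|_{H^2}$ in the following sense. There are real polynomials $P,Q$ with $P(0)=Q(0)=0$ such that for every such $u$ and its Coulomb frame the left-hand side is finite if and only if the right-hand side is finite, and in that case $$\|u\|_{\mathfrak{H}^3}\le P\big(\|R_+\psi^+\|_{H^2}+\|R_-\psi^-\|_{H^2}\big),\qquad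 \|R_+\psi^+\|_{H^2}+\|R_-\psi^-\|_{H^2}\le Q\big(\|u\|_{\mathfrak{H}^3}\big).$$ -/

import Mathlib

open MeasureTheory Set Filter Topology
open scoped ENNReal

namespace HypMap

noncomputable section

/-- Euclidean three-space, ambient space of both the hyperboloid and the target sphere. -/
abbrev E3 : Type := EuclideanSpace ℝ (Fin 3)

/-- The hyperbolic plane, as the upper sheet of the hyperboloid in Minkowski space. -/
def Hyp : Type := {x : E3 // x 2 ^ 2 - x 0 ^ 2 - x 1 ^ 2 = 1 ∧ 0 < x 2}

/-- The unit two-sphere. -/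
abbrev S2 : Type := Metric.sphere (0 : E3) 1

/-- The horizontal rotation by the angle `θ`, that is `exp (θ R)` with `R x = k × x`. -/
def rot (θ : ℝ) (x : E3) : E3 :=
  !₂[Real.cos θ * x 0 - Real.sin θ * x 1, Real.sin θ * x 0 + Real.cos θ * x 1, x 2]

theorem rot_mem (θ : ℝ) (x : Hyp) :
    (rot θ x.1) 2 ^ 2 - (rot θ x.1) 0 ^ 2 - (rot θ x.1) 1 ^ 2 = 1 ∧ 0 < (rot θ x.1) 2 := by
  obtain ⟨x, h1, h2⟩ := x
  refine ⟨?_, by simpa [rot] using h2⟩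
  simp only [rot, Matrix.cons_val_zero, Matrix.cons_val_one, Matrix.cons_val]
  linear_combination h1 - (x 0 ^ 2 + x 1 ^ 2) * (Real.sin_sq_add_cos_sq θ)

/-- Rotations of the hyperbolic plane about its origin `(0, 0, 1)`. -/
def rotHyp (θ : ℝ) (x : Hyp) : Hyp := ⟨rot θ x.1, rot_mem θ x⟩

theorem polar_mem (r θ : ℝ) :
    let x : E3 := !₂[Real.sinh r * Real.cos θ, Real.sinh r * Real.sin θ, Real.cosh r]
    x 2 ^ 2 - x 0 ^ 2 - x 1 ^ 2 = 1 ∧ 0 < x 2 := by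
  refine ⟨?_, by simpa using Real.cosh_pos r⟩
  simp only [PiLp.toLp_apply, Matrix.cons_val_zero, Matrix.cons_val_one, Matrix.cons_val]
  linear_combination Real.cosh_sq_sub_sinh_sq r
    - Real.sinh r ^ 2 * (Real.sin_sq_add_cos_sq θ)

/-- Geodesic polar coordinates about the origin. -/
def polar (r θ : ℝ) : Hyp :=
  ⟨!₂[Real.sinh r * Real.cos θ, Real.sinh r * Real.sin θ, Real.cosh r], polar_mem r θ⟩

/-- A map in polar coordinates, with values in the ambient space of the sphere. -/
def inPolar (u : Hyp → S2) (r θ : ℝ) : E3 := (u (polar r θ)).1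

/-- `1`-equivariance: `u ∘ ρ = ρ ∘ u` for all rotations `ρ`. -/
def Equivariant (u : Hyp → S2) : Prop :=
  ∀ (θ : ℝ) (x : Hyp), (u (rotHyp θ x)).1 = rot θ (u x).1

/-! ### Tensor calculus in the orthonormal frame `e₀ = ∂_r`, `e₁ = (sinh r)⁻¹ ∂_θ`

The metric is `dr² + sinh² r dθ²`. A tensor field of rank `n` with values in `E` is given by its
components in this frame, a function of the `n` frame indices and of `(r, θ)`, `r > 0`. -/

section Tensor

variable {E : Type*} [NormedAddCommGroup E] [NormedSpace ℝ E]

/-- The derivative of a function along the frame vector `e_j`. -/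
def frameDeriv (j : Fin 2) (f : ℝ → ℝ → E) (r θ : ℝ) : E :=
  if j = 0 then deriv (fun s => f s θ) r else (Real.sinh r)⁻¹ • deriv (fun t => f r t) θ

/-- The Levi-Civita connection coefficients `⟨∇_{e_j} e_i, e_l⟩`: the only non-zero ones come from
`∇_{e₁} e₀ = coth r e₁` and `∇_{e₁} e₁ = - coth r e₀`. -/
def conn (r : ℝ) (j i l : Fin 2) : ℝ :=
  if j = 1 ∧ i = 0 ∧ l = 1 then Real.cosh r / Real.sinh r
  else if j = 1 ∧ i = 1 ∧ l = 0 then -(Real.cosh r / Real.sinh r)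
  else 0

/-- The covariant derivative of an `E`-valued tensor field `T` of rank `n`; the index `0` of the
result is the direction of differentiation:
`(∇T)(e_j, e_{i₁}, …) = e_j (T(e_{i₁}, …)) - ∑ₐ T(…, ∇_{e_j} e_{iₐ}, …)`. -/
def covDeriv {n : ℕ} (T : (Fin n → Fin 2) → ℝ → ℝ → E) (I : Fin (n + 1) → Fin 2) (r θ : ℝ) : E :=
  frameDeriv (I 0) (T (Fin.tail I)) r θ
    - ∑ a : Fin n, ∑ l : Fin 2,
        conn r (I 0) (Fin.tail I a) l • T (Function.update (Fin.tail I) a l) r θ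

/-- The iterated covariant derivative `∇^l f` of a function `f`. -/
def iterCov (f : ℝ → ℝ → E) : (l : ℕ) → (Fin l → Fin 2) → ℝ → ℝ → E
  | 0 => fun _ => f
  | l + 1 => covDeriv (iterCov f l)

/-- `∫ |T|² dvol`, where `dvol = sinh r dr dθ`. -/
def sqIntegral {n : ℕ} (T : (Fin n → Fin 2) → ℝ → ℝ → E) : ℝ≥0∞ :=
  ∫⁻ r in Ioi (0 : ℝ), ∫⁻ θ in Ioc (0 : ℝ) (2 * Real.pi),
    ENNReal.ofReal ((∑ I : Fin n → Fin 2, ‖T I r θ‖ ^ 2) * Real.sinh r)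

/-- Local Sobolev regularity of order `k` on `(0, ∞)`: the function and its derivatives of order
less than `k` are locally absolutely continuous. -/
def SobolevLoc : ℕ → (ℝ → E) → Prop
  | 0, _ => True
  | k + 1, f =>
      (∀ a b : ℝ, 0 < a → a < b → AbsolutelyContinuousOnInterval f a b) ∧ SobolevLoc k (deriv f)

open Classical in
/-- The norm of the Sobolev space `H^k` of the hyperbolic plane, for a function `f` in polar
coordinates: `‖f‖² = ∑_{l ≤ k} ∫ |∇^l f|² dvol`; it is `∞` if `f` is not regular enough.
For a function of the form `e^{imθ} g(r)`, having weak derivatives up to order `k` away from the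
origin means exactly that `g` is in `SobolevLoc k`, and then `∇^l f`, `l ≤ k`, exists almost
everywhere. A point is removable for square integrable weak derivatives. Smooth functions are
always regular in this sense. -/
def sobolevNorm (k : ℕ) (f : ℝ → ℝ → E) : ℝ≥0∞ :=
  if ∀ θ, SobolevLoc k (fun r => f r θ) then
    (∑ l ∈ Finset.range (k + 1), sqIntegral (iterCov f l)) ^ (1 / 2 : ℝ)
  else ∞

end Tensor

/-! ### Maps into the sphere -/

/-- The orthogonal projection of the ambient space onto the tangent plane of the sphere at `y`. -/
def tangentProj (y X : E3) : E3 := X - inner ℝ y X • y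

/-- `∇^i du`, a tensor field of rank `i + 1` with values in `u^*TS²`: `du` is the derivative of
`u`, and the induced connection on `u^*TS²` is the ambient derivative followed by the projection
onto the tangent plane at `u`. -/
def iterCovMap (U : ℝ → ℝ → E3) : (i : ℕ) → (Fin (i + 1) → Fin 2) → ℝ → ℝ → E3
  | 0 => covDeriv (n := 0) (fun _ => U)
  | i + 1 => fun I r θ => tangentProj (U r θ) (covDeriv (iterCovMap U i) I r θ)

open Classical in
/-- The intrinsic Sobolev norm of a map, `‖u‖² = ∑_{i=1}^k ∫ |∇^{i-1} du|² dvol`; it is `∞` if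
`u` is not regular enough, in the same sense as in `sobolevNorm`: for an equivariant `u`, which is
`exp (θ R) ū(r)`, weak derivatives up to order `k` exist away from the origin if and only if
the profile `ū` is in `SobolevLoc k`. -/
def mapNorm (k : ℕ) (u : Hyp → S2) : ℝ≥0∞ :=
  if ∀ θ, SobolevLoc k (fun r => inPolar u r θ) then
    (∑ i ∈ Finset.range k, sqIntegral (iterCovMap (inPolar u) i)) ^ (1 / 2 : ℝ)
  else ∞

open Classical in
/-- The energy `E(u) = 1/2 ∫ |du|² dvol`, which is `∞` for maps without a weak derivative. -/
def energy (u : Hyp → S2) : ℝ≥0∞ :=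
  if ∀ θ, SobolevLoc 1 (fun r => inPolar u r θ) then sqIntegral (iterCovMap (inPolar u) 0) / 2
  else ∞

/-- The class `𝓔₀`: finite energy, and `u₃ → 1` both as `r → 0` and as `r → ∞`. -/
structure ClassE0 (u : Hyp → S2) : Prop where
  energy_lt_top : energy u < ∞
  tendsto_zero : Tendsto (fun p : ℝ × ℝ => inPolar u p.1 p.2 2) (𝓝[>] 0 ×ˢ ⊤) (𝓝 1)
  tendsto_infty : Tendsto (fun p : ℝ × ℝ => inPolar u p.1 p.2 2) (atTop ×ˢ ⊤) (𝓝 1)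

/-! ### The Coulomb gauge and the differentiated fields -/

/-- The cross product on `E3`. -/
def cross (x y : E3) : E3 := WithLp.toLp 2 (crossProduct x.ofLp y.ofLp)

/-- The radial profile `ū(r)` of an equivariant map `u = exp (θ R) ū(r)`. -/
def profile (u : Hyp → S2) (r : ℝ) : E3 := inPolar u r 0

/-- `v̄` is the profile of the Coulomb frame `v = exp (θ R) v̄(r)`, `w = u × v` along `u`:
`v̄` is a unit tangent vector at `ū`, it solves `∂_r v̄ = -(v̄ · ∂_r ū) ū` (which is the gauge
condition `A₁ = ∂_r v · w = 0`), and `v̄ → (1,0,0)`, `w̄ = ū × v̄ → (0,1,0)` as `r → ∞`. -/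
structure IsCoulombFrame (u : Hyp → S2) (v : ℝ → E3) : Prop where
  absCont : ∀ a b : ℝ, 0 < a → a < b → AbsolutelyContinuousOnInterval v a b
  norm_eq_one : ∀ r, 0 < r → ‖v r‖ = 1
  tangent : ∀ r, 0 < r → inner ℝ (v r) (profile u r) = 0
  ode : ∀ᵐ r ∂(volume.restrict (Ioi (0 : ℝ))),
    HasDerivAt v (-(inner ℝ (v r) (deriv (profile u) r) • profile u r)) r
  tendsto_v : Tendsto v atTop (𝓝 !₂[1, 0, 0])
  tendsto_w : Tendsto (fun r => cross (profile u r) (v r)) atTop (𝓝 !₂[0, 1, 0])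

/-- The frame vector `v = exp (θ R) v̄(r)`. -/
def frameV (v : ℝ → E3) (r θ : ℝ) : E3 := rot θ (v r)

/-- The frame vector `w = u × v`. -/
def frameW (u : Hyp → S2) (v : ℝ → E3) (r θ : ℝ) : E3 := cross (inPolar u r θ) (frameV v r θ)

/-- The complex coordinate `X · v + i X · w` of a vector `X` in the frame `(v, w)`. -/
def frameCoord (u : Hyp → S2) (v : ℝ → E3) (r θ : ℝ) (X : E3) : ℂ :=
  (inner ℝ X (frameV v r θ) : ℝ) + Complex.I * (inner ℝ X (frameW u v r θ) : ℝ)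

/-- `ψ₁ = ∂_r u · v + i ∂_r u · w`. -/
def psi1 (u : Hyp → S2) (v : ℝ → E3) (r θ : ℝ) : ℂ :=
  frameCoord u v r θ (deriv (fun s => inPolar u s θ) r)

/-- `ψ₂ = ∂_θ u · v + i ∂_θ u · w`. -/
def psi2 (u : Hyp → S2) (v : ℝ → E3) (r θ : ℝ) : ℂ :=
  frameCoord u v r θ (deriv (fun t => inPolar u r t) θ)

/-- `ψ⁺ = ψ₁ + i ψ₂ / sinh r`. -/
def psiPlus (u : Hyp → S2) (v : ℝ → E3) (r θ : ℝ) : ℂ :=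
  psi1 u v r θ + Complex.I * (psi2 u v r θ / (Real.sinh r : ℂ))

/-- `ψ⁻ = ψ₁ - i ψ₂ / sinh r`. -/
def psiMinus (u : Hyp → S2) (v : ℝ → E3) (r θ : ℝ) : ℂ :=
  psi1 u v r θ - Complex.I * (psi2 u v r θ / (Real.sinh r : ℂ))

/-- `R₊ f = e^{2iθ} f`. -/
def RPlus (f : ℝ → ℝ → ℂ) (r θ : ℝ) : ℂ := Complex.exp (2 * Complex.I * (θ : ℂ)) * f r θ

/-- `R₋ f = f`. -/
def RMinus (f : ℝ → ℝ → ℂ) : ℝ → ℝ → ℂ := f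

/-- `‖R₊ ψ⁺‖_{H²} + ‖R₋ ψ⁻‖_{H²}`. -/
def fieldNorm (u : Hyp → S2) (v : ℝ → E3) : ℝ≥0∞ :=
  sobolevNorm 2 (RPlus (psiPlus u v)) + sobolevNorm 2 (RMinus (psiMinus u v))

end

end HypMap

/-! By equivariance everything reduces to radial profiles on `(0, ∞)`. The Coulomb condition makes
the covariant radial derivative of a section of `u^*TS²` the ordinary derivative of its complex
coordinate, and `e^{θR}` makes the covariant angular derivative multiplication by `i κ`, where `κ =
u₃`. In the splitting of the last covector slot by `x ± i y`, the one-form `du` has components `ψ⁺`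
and `ψ⁻`, and the Levi-Civita connection adds `± coth r` to the angular multiplier `csch r · κ`. The
parallelogram identity then shows that `|du|² + |∇du|² + |∇²du|²` is half the sum of two scalar
densities, of `ψ⁺` with multiplier `csch · κ + coth` and of `ψ⁻` with multiplier `csch · κ - coth`
(`sum_radCov_oneForm`, `sum_radCov_radCov_oneForm`). The `H²` norms of `R₊ψ⁺` and `R₋ψ⁻` are
integrals of the same densities with multipliers `2 csch` and `0`. So the theorem compares two pairs
of multipliers.

They agree at the origin to the required order because `κ → 1` there. Quantitatively, `κ' = sinh ·
Re(ψ₁ z̄)` with `ψ^± = ψ₁ ± z`, so `|κ'| ≤ sinh · (|ψ⁺|² + |ψ⁻|²) / 4`. Let `N` bound either of the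
two energies. A one-dimensional Sobolev estimate gives `sinh · |ψ^±|² ≤ N`, hence `csch · (1 - κ) ≤
N`, and the differences of the multipliers are bounded. With this, `ψ^±` are bounded uniformly, so
`|κ'| ≲ sinh`, and `csch² (1 - κ)` and `csch |κ'|` are bounded too (`FieldTriple.height_bounds`).
These bounds make the densities pointwise comparable with a constant polynomial in `N`
(`multiplier_estimates`, `density_le_density`). The argument starts from either energy, so
finiteness and the polynomial bounds pass in both directions (`FieldTriple.fieldEnergy_comparable`,
`norms_comparable`).

Regularity is transferred separately: the structure equations of the frame bootstrap between `ū`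
with three weak derivatives and `ψ^±` with two. -/

namespace HypMap

/-! ### Local absolute continuity and higher regularity on the half-line -/

section Regularity

variable {E F G : Type*} [NormedAddCommGroup E] [NormedSpace ℝ E] [NormedAddCommGroup F]
  [NormedSpace ℝ F] [NormedAddCommGroup G] [NormedSpace ℝ G]

/-- Local absolute continuity on `(0, ∞)`. -/
def LAC (f : ℝ → E) : Prop :=
  ∀ a b : ℝ, 0 < a → a < b → AbsolutelyContinuousOnInterval f a b

/-- The usual product estimate, in bilinear form so that scalar, inner, cross and complex products
are all instances. -/
theorem absolutelyContinuousOnInterval_bilin (B : E →L[ℝ] F →L[ℝ] G) {f : ℝ → E} {g : ℝ → F}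
    {a b : ℝ} (hf : AbsolutelyContinuousOnInterval f a b)
    (hg : AbsolutelyContinuousOnInterval g a b) :
    AbsolutelyContinuousOnInterval (fun x => B (f x) (g x)) a b := by
  obtain ⟨C, hC⟩ := hf.exists_bound
  obtain ⟨D, hD⟩ := hg.exists_bound
  have hf' := hf
  have hg' := hg
  unfold AbsolutelyContinuousOnInterval at hf hg
  apply squeeze_zero' ?_ ?_
    (by simpa using (hg.const_mul (‖B‖ * C)).add (hf.const_mul (‖B‖ * D)))
  · exact Filter.Eventually.of_forall <| fun _ ↦ Finset.sum_nonneg (fun i hi ↦ dist_nonneg)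
  rw [eventually_inf_principal]
  filter_upwards with (n, I) hnI
  simp only [Finset.mul_sum, ← Finset.sum_add_distrib]
  gcongr with i hi
  have hI := hnI.left i hi
  have h1 := hC _ hI.left
  have h2 := hD _ hI.right
  have e : B (f (I i).1) (g (I i).1) - B (f (I i).2) (g (I i).2)
      = B (f (I i).1) (g (I i).1 - g (I i).2) + B (f (I i).1 - f (I i).2) (g (I i).2) := by
    simp
  simp only [dist_eq_norm]
  rw [e]
  refine (norm_add_le _ _).trans (add_le_add ((B.le_opNorm₂ _ _).trans ?_)
    ((B.le_opNorm₂ _ _).trans ?_))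
  · gcongr
  · rw [mul_right_comm]
    gcongr

theorem absolutelyContinuousOnInterval_congr {X : Type*} [NormedAddCommGroup X] {f g : ℝ → X} {a b : ℝ}
    (hf : AbsolutelyContinuousOnInterval f a b) (h : ∀ x ∈ uIcc a b, f x = g x) :
    AbsolutelyContinuousOnInterval g a b := by
  rw [absolutelyContinuousOnInterval_iff] at hf ⊢
  intro ε hε
  obtain ⟨δ, hδ, H⟩ := hf ε hε
  refine ⟨δ, hδ, fun K hK hlen => ?_⟩
  have := H K hK hlen
  refine lt_of_le_of_lt (le_of_eq (Finset.sum_congr rfl fun i hi => ?_)) this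
  rw [h _ (hK.1 i hi).1, h _ (hK.1 i hi).2]

theorem uIcc_subset_Ioi {a b : ℝ} (ha : 0 < a) (hab : a < b) : uIcc a b ⊆ Ioi 0 := by
  rw [uIcc_of_le hab.le]
  exact fun x hx => ha.trans_le hx.1

set_option linter.unusedSectionVars false in
theorem LAC.congr {f g : ℝ → E} (hf : LAC f) (h : ∀ r, 0 < r → f r = g r) : LAC g :=
  fun a b ha hab => absolutelyContinuousOnInterval_congr (hf a b ha hab)
    fun x hx => h x (uIcc_subset_Ioi ha hab hx)

theorem LAC.bilin (B : E →L[ℝ] F →L[ℝ] G) {f : ℝ → E} {g : ℝ → F} (hf : LAC f) (hg : LAC g) :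
    LAC (fun r => B (f r) (g r)) :=
  fun a b ha hab => absolutelyContinuousOnInterval_bilin B (hf a b ha hab) (hg a b ha hab)

set_option linter.unusedSectionVars false in
theorem LAC.add {f g : ℝ → E} (hf : LAC f) (hg : LAC g) : LAC (fun r => f r + g r) :=
  fun a b ha hab => (hf a b ha hab).add (hg a b ha hab)

set_option linter.unusedSectionVars false in
theorem LAC.continuousOn {f : ℝ → E} (hf : LAC f) : ContinuousOn f (Ioi 0) := by
  intro r hr
  have hr : 0 < r := hr
  have h := (hf (r / 2) (2 * r) (by linarith) (by linarith)).continuousOn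
  rw [uIcc_of_le (by linarith)] at h
  exact (h.continuousAt (Icc_mem_nhds (by linarith) (by linarith))).continuousWithinAt

theorem LAC.of_hasDerivAt {f f' : ℝ → E} (h : ∀ r, 0 < r → HasDerivAt f (f' r) r)
    (hf' : ContinuousOn f' (Ioi 0)) : LAC f := by
  intro a b ha hab
  have hs := uIcc_subset_Ioi ha hab
  obtain ⟨C, hC⟩ := isCompact_uIcc.exists_bound_of_continuousOn (hf'.mono hs)
  have : LipschitzOnWith (Real.toNNReal C) f (uIcc a b) := by
    refine (convex_uIcc a b).lipschitzOnWith_of_nnnorm_hasDerivWithin_le (f' := f')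
      (fun x hx => (h x (hs hx)).hasDerivWithinAt) fun x hx => ?_
    rw [← NNReal.coe_le_coe]
    exact (hC x hx).trans (Real.le_coe_toNNReal C)
  exact this.absolutelyContinuousOnInterval

theorem LAC.ae_differentiableAt [FiniteDimensional ℝ E] {f : ℝ → E} (hf : LAC f) :
    ∀ᵐ r ∂(volume.restrict (Ioi (0 : ℝ))), DifferentiableAt ℝ f r := by
  rw [ae_restrict_iff' measurableSet_Ioi]
  have h : ∀ n : ℕ, ∀ᵐ r : ℝ, r ∈ uIcc ((1 : ℝ) / (n + 2)) (n + 2) → DifferentiableAt ℝ f r := by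
    intro n
    refine ((hf _ _ (by positivity) ?_).boundedVariationOn).ae_differentiableAt_of_mem_uIcc
    rw [div_lt_iff₀ (by positivity)]
    nlinarith [(Nat.cast_nonneg n : (0 : ℝ) ≤ n)]
  filter_upwards [ae_all_iff.2 h] with r hr hr0
  have hr0 : 0 < r := hr0
  obtain ⟨n, hn⟩ := exists_nat_gt (max r (1 / r))
  refine hr n ?_
  have h1 := (le_max_left r (1 / r)).trans hn.le
  have h2 := (le_max_right r (1 / r)).trans hn.le
  rw [mem_uIcc]
  left
  refine ⟨?_, by linarith⟩
  rw [div_le_iff₀ hr0] at h2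
  rw [div_le_iff₀ (by positivity)]
  nlinarith

/-- The difference of `f` and a primitive of `g` is absolutely continuous with derivative zero
almost everywhere, hence constant. This is how equations known almost everywhere become classical
ones. -/
theorem LAC.hasDerivAt_of_ae [CompleteSpace E] {f g : ℝ → E} (hf : LAC f)
    (h : ∀ᵐ r ∂(volume.restrict (Ioi (0 : ℝ))), HasDerivAt f (g r) r)
    (hg : ContinuousOn g (Ioi 0)) (r : ℝ) (hr : 0 < r) : HasDerivAt f (g r) r := by
  have hG : ∀ x, 0 < x → HasDerivAt (fun x => ∫ s in r..x, g s) (g x) x := by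
    intro x hx
    refine intervalIntegral.integral_hasDerivAt_right ?_ ?_ (hg.continuousAt (Ioi_mem_nhds hx))
    · refine (hg.mono ?_).intervalIntegrable
      intro y hy
      exact lt_of_lt_of_le (lt_min hr hx) hy.1
    · exact hg.stronglyMeasurableAtFilter isOpen_Ioi _ hx
  have hGac := LAC.of_hasDerivAt hG hg
  have hab : r / 2 < 2 * r := by linarith
  have h0 := (hf (r / 2) (2 * r) (by linarith) hab).sub (hGac (r / 2) (2 * r) (by linarith) hab)
  obtain ⟨C, hC⟩ := h0.const_of_ae_hasDerivAt_zero (by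
    rw [ae_restrict_iff' measurableSet_Ioi] at h
    filter_upwards [h] with x hx hxm
    have hx0 := uIcc_subset_Ioi (by linarith : 0 < r / 2) hab hxm
    simpa using (hx hx0).sub (hG x hx0))
  have heq : f =ᶠ[𝓝 r] fun x => (∫ s in r..x, g s) + C := by
    filter_upwards [Icc_mem_nhds (by linarith : r / 2 < r) (by linarith : r < 2 * r)] with x hx
    have := hC x (by rwa [uIcc_of_le hab.le])
    simp only [Pi.sub_apply] at this
    rw [← this]; abel
  exact ((hG r hr).add_const C).congr_of_eventuallyEq heq

/-- `n` continuous derivatives on `(0, ∞)`, the last of which is locally absolutely continuous. -/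
def Reg : ℕ → (ℝ → E) → Prop
  | 0, f => LAC f
  | n + 1, f => ∃ f' : ℝ → E, (∀ r, 0 < r → HasDerivAt f (f' r) r) ∧ Reg n f'

theorem Reg.lac {n : ℕ} {f : ℝ → E} (hf : Reg n f) : LAC f := by
  induction n generalizing f with
  | zero => exact hf
  | succ n ih =>
    obtain ⟨f', h, hf'⟩ := hf
    exact LAC.of_hasDerivAt h (ih hf').continuousOn

theorem Reg.congr {n : ℕ} {f g : ℝ → E} (hf : Reg n f) (h : ∀ r, 0 < r → f r = g r) :
    Reg n g := by
  cases n with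
  | zero => exact LAC.congr hf h
  | succ n =>
    obtain ⟨f', hd, hf'⟩ := hf
    refine ⟨f', fun r hr => (hd r hr).congr_of_eventuallyEq ?_, hf'⟩
    filter_upwards [Ioi_mem_nhds hr] with x hx using (h x hx).symm

theorem Reg.of_succ {n : ℕ} {f : ℝ → E} (hf : Reg (n + 1) f) : Reg n f := by
  induction n generalizing f with
  | zero => exact hf.lac
  | succ n ih =>
    obtain ⟨f', h, hf'⟩ := hf
    exact ⟨f', h, ih hf'⟩

theorem Reg.add {n : ℕ} {f g : ℝ → E} (hf : Reg n f) (hg : Reg n g) :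
    Reg n (fun r => f r + g r) := by
  induction n generalizing f g with
  | zero => exact LAC.add hf hg
  | succ n ih =>
    obtain ⟨f', h, hf'⟩ := hf
    obtain ⟨g', k, hg'⟩ := hg
    exact ⟨_, fun r hr => (h r hr).add (k r hr), ih hf' hg'⟩

theorem Reg.bilin (B : E →L[ℝ] F →L[ℝ] G) {n : ℕ} {f : ℝ → E} {g : ℝ → F} (hf : Reg n f)
    (hg : Reg n g) : Reg n (fun r => B (f r) (g r)) := by
  induction n generalizing f g with
  | zero => exact LAC.bilin B hf hg
  | succ n ih =>
    have hf0 := hf.of_succ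
    have hg0 := hg.of_succ
    obtain ⟨f', h, hf'⟩ := hf
    obtain ⟨g', k, hg'⟩ := hg
    refine ⟨_, fun r hr => ?_, (ih hf' hg0).add (ih hf0 hg')⟩
    exact (B.hasFDerivAt.comp_hasDerivAt r (h r hr)).clm_apply (k r hr)

theorem Reg.const (n : ℕ) (x : E) : Reg n (fun _ => x) := by
  induction n generalizing x with
  | zero => exact LAC.of_hasDerivAt (fun r _ => hasDerivAt_const r x) continuousOn_const
  | succ n ih => exact ⟨_, fun r _ => hasDerivAt_const r x, ih 0⟩

theorem Reg.clm (L : E →L[ℝ] F) {n : ℕ} {f : ℝ → E} (hf : Reg n f) :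
    Reg n (fun r => L (f r)) :=
  Reg.bilin (ContinuousLinearMap.id ℝ (E →L[ℝ] F)) (Reg.const n L) hf

theorem Reg.smul {n : ℕ} {f : ℝ → ℝ} {g : ℝ → E} (hf : Reg n f) (hg : Reg n g) :
    Reg n (fun r => f r • g r) :=
  Reg.bilin (ContinuousLinearMap.lsmul ℝ ℝ) hf hg

theorem Reg.of_contDiffOn {f : ℝ → E} (n : ℕ) (hf : ContDiffOn ℝ (n + 1) f (Ioi 0)) :
    Reg n f := by
  induction n generalizing f with
  | zero =>
    have := (contDiffOn_succ_iff_deriv_of_isOpen (n := 0) isOpen_Ioi).1 (by simpa using hf)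
    exact LAC.of_hasDerivAt (fun r hr => ((this.1 r hr).differentiableAt
      (Ioi_mem_nhds hr)).hasDerivAt) this.2.2.continuousOn
  | succ n ih =>
    have := (contDiffOn_succ_iff_deriv_of_isOpen (n := n + 1) isOpen_Ioi).1 (by simpa using hf)
    exact ⟨_, fun r hr => ((this.1 r hr).differentiableAt (Ioi_mem_nhds hr)).hasDerivAt,
      ih this.2.2⟩

/-- `SobolevLoc` speaks of `deriv`, which has the value zero where no derivative exists; when `deriv
f` is itself absolutely continuous it is continuous, so `f` is differentiable everywhere on `(0,
∞)`. The shift occurs because `Reg n` counts the classical derivatives, one fewer than the weak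
ones. -/
theorem reg_iff_sobolevLoc [FiniteDimensional ℝ E] (n : ℕ) (f : ℝ → E) :
    Reg n f ↔ SobolevLoc (n + 1) f := by
  have := FiniteDimensional.complete ℝ E
  induction n generalizing f with
  | zero => simp [Reg, SobolevLoc, LAC]
  | succ n ih =>
    constructor
    · intro hf
      refine ⟨hf.lac, ?_⟩
      obtain ⟨f', h, hf'⟩ := hf
      exact (ih _).1 (hf'.congr fun r hr => (h r hr).deriv.symm)
    · rintro ⟨h1, h2⟩
      have h2 := (ih _).2 h2
      refine ⟨deriv f, fun r hr => ?_, h2⟩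
      exact LAC.hasDerivAt_of_ae h1 ((LAC.ae_differentiableAt h1).mono fun x hx => hx.hasDerivAt)
        h2.lac.continuousOn r hr

end Regularity

/-! ### Rotations, orthonormal frames and the complex coordinate of a tangent vector -/

section Frames

theorem inner_E3 (x y : E3) : inner ℝ x y = x 0 * y 0 + x 1 * y 1 + x 2 * y 2 := by
  simp [PiLp.inner_apply, Fin.sum_univ_three, mul_comm]

theorem ext_E3 {x y : E3} (h0 : x 0 = y 0) (h1 : x 1 = y 1) (h2 : x 2 = y 2) : x = y := by
  ext i
  fin_cases i
  exacts [h0, h1, h2]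

theorem cross_zero (x y : E3) : cross x y 0 = x 1 * y 2 - x 2 * y 1 := by
  simp [cross, cross_apply]

theorem cross_one (x y : E3) : cross x y 1 = x 2 * y 0 - x 0 * y 2 := by
  simp [cross, cross_apply]

theorem cross_two (x y : E3) : cross x y 2 = x 0 * y 1 - x 1 * y 0 := by
  simp [cross, cross_apply]

theorem rot_zero_apply (θ : ℝ) (x : E3) : rot θ x 0 = Real.cos θ * x 0 - Real.sin θ * x 1 := by
  simp [rot]

theorem rot_one_apply (θ : ℝ) (x : E3) : rot θ x 1 = Real.sin θ * x 0 + Real.cos θ * x 1 := by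
  simp [rot]

theorem rot_two_apply (θ : ℝ) (x : E3) : rot θ x 2 = x 2 := by
  simp [rot]

theorem inner_rot (θ : ℝ) (x y : E3) : inner ℝ (rot θ x) (rot θ y) = inner ℝ x y := by
  simp only [inner_E3, rot_zero_apply, rot_one_apply, rot_two_apply]
  linear_combination (x 0 * y 0 + x 1 * y 1) * Real.sin_sq_add_cos_sq θ

theorem cross_rot (θ : ℝ) (x y : E3) : cross (rot θ x) (rot θ y) = rot θ (cross x y) := by
  apply ext_E3 <;> simp only [cross_zero, cross_one, cross_two, rot_zero_apply, rot_one_apply,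
    rot_two_apply]
  · ring
  · ring
  · linear_combination (x 0 * y 1 - x 1 * y 0) * Real.sin_sq_add_cos_sq θ

theorem rot_rot (θ φ : ℝ) (x : E3) : rot θ (rot φ x) = rot (θ + φ) x := by
  apply ext_E3 <;> simp only [rot_zero_apply, rot_one_apply, rot_two_apply, Real.cos_add,
    Real.sin_add] <;> ring

theorem rot_angle_zero (x : E3) : rot 0 x = x := by
  apply ext_E3 <;> simp [rot_zero_apply, rot_one_apply, rot_two_apply]

/-- The rotation by `θ` as a continuous linear equivalence. -/
noncomputable def rotEquiv (θ : ℝ) : E3 ≃L[ℝ] E3 :=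
  LinearEquiv.toContinuousLinearEquiv
    { toFun := rot θ
      invFun := rot (-θ)
      map_add' := fun x y => by
        apply ext_E3 <;> simp only [rot_zero_apply, rot_one_apply, rot_two_apply, PiLp.add_apply]
          <;> ring
      map_smul' := fun c x => by
        apply ext_E3 <;> simp only [rot_zero_apply, rot_one_apply, rot_two_apply, PiLp.smul_apply,
          smul_eq_mul, RingHom.id_apply] <;> ring
      left_inv := fun x => by rw [rot_rot, neg_add_cancel, rot_angle_zero]
      right_inv := fun x => by rw [rot_rot, add_neg_cancel, rot_angle_zero] }

theorem rotEquiv_apply (θ : ℝ) (x : E3) : rotEquiv θ x = rot θ x := rfl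

/-- A rotation is a linear equivalence, so no differentiability of `f` is needed: both sides vanish
where `f` is not differentiable. -/
theorem deriv_rot (θ : ℝ) (f : ℝ → E3) (r : ℝ) :
    deriv (fun s => rot θ (f s)) r = rot θ (deriv f r) := by
  have := (rotEquiv θ).comp_fderiv (f := f) (x := r)
  have h2 := congrArg (fun L : ℝ →L[ℝ] E3 => L 1) this
  simpa [fderiv_apply_one_eq_deriv, Function.comp_def, rotEquiv_apply] using h2

/-- The generator `x ↦ k × x` of the horizontal rotations. -/
noncomputable def kCross (x : E3) : E3 := !₂[-x 1, x 0, 0]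

theorem kCross_zero (x : E3) : kCross x 0 = -x 1 := by simp [kCross]
theorem kCross_one (x : E3) : kCross x 1 = x 0 := by simp [kCross]
theorem kCross_two (x : E3) : kCross x 2 = 0 := by simp [kCross]

theorem hasDerivAt_E3 {f : ℝ → E3} {f' : E3} {t : ℝ} (h0 : HasDerivAt (fun t => f t 0) (f' 0) t)
    (h1 : HasDerivAt (fun t => f t 1) (f' 1) t) (h2 : HasDerivAt (fun t => f t 2) (f' 2) t) :
    HasDerivAt f f' t := by
  have h : HasDerivAt (fun t => (f t).ofLp) f'.ofLp t := by
    rw [hasDerivAt_pi]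
    intro i
    fin_cases i
    exacts [h0, h1, h2]
  have := (PiLp.continuousLinearEquiv 2 ℝ (fun _ : Fin 3 => ℝ)).symm.hasFDerivAt.comp_hasDerivAt t h
  exact this

theorem hasDerivAt_rot (x : E3) (θ : ℝ) :
    HasDerivAt (fun t => rot t x) (rot θ (kCross x)) θ := by
  have hs := Real.hasDerivAt_sin θ
  have hc := Real.hasDerivAt_cos θ
  apply hasDerivAt_E3 <;> simp only [rot_zero_apply, rot_one_apply, rot_two_apply, kCross_zero,
    kCross_one, kCross_two]
  · exact ((hc.mul_const (x 0)).sub (hs.mul_const (x 1))).congr_deriv (by ring)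
  · exact ((hs.mul_const (x 0)).add (hc.mul_const (x 1))).congr_deriv (by ring)
  · exact hasDerivAt_const _ _

/-- `U`, `V` are orthonormal. -/
structure IsONPair (U V : E3) : Prop where
  left : inner ℝ U U = 1
  right : inner ℝ V V = 1
  orth : inner ℝ V U = 0

namespace IsONPair

variable {U V : E3}

theorem coords (h : IsONPair U V) :
    (U 0 ^ 2 + U 1 ^ 2 + U 2 ^ 2 = 1 ∧ V 0 ^ 2 + V 1 ^ 2 + V 2 ^ 2 = 1 ∧
      V 0 * U 0 + V 1 * U 1 + V 2 * U 2 = 0) := by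
  obtain ⟨h1, h2, h3⟩ := h
  rw [inner_E3] at h1 h2 h3
  exact ⟨by linarith, by linarith, h3⟩

theorem rot (h : IsONPair U V) (θ : ℝ) : IsONPair (HypMap.rot θ U) (HypMap.rot θ V) :=
  ⟨by rw [inner_rot, h.left], by rw [inner_rot, h.right], by rw [inner_rot, h.orth]⟩

theorem cross_cross (h : IsONPair U V) : inner ℝ (cross U V) (cross U V) = 1 := by
  obtain ⟨h1, h2, h3⟩ := h.coords
  simp only [inner_E3, cross_zero, cross_one, cross_two]
  linear_combination (V 0 ^ 2 + V 1 ^ 2 + V 2 ^ 2) * h1 + h2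
    - (V 0 * U 0 + V 1 * U 1 + V 2 * U 2) * h3

theorem cross_left (U V : E3) : inner ℝ (cross U V) U = 0 := by
  simp only [inner_E3, cross_zero, cross_one, cross_two]; ring

theorem cross_right (U V : E3) : inner ℝ (cross U V) V = 0 := by
  simp only [inner_E3, cross_zero, cross_one, cross_two]; ring

theorem cross_cross_right (h : IsONPair U V) : cross (cross U V) V = -U := by
  obtain ⟨h1, h2, h3⟩ := h.coords
  apply ext_E3 <;> simp only [cross_zero, cross_one, cross_two, PiLp.neg_apply]
  · linear_combination V 0 * h3 - U 0 * h2
  · linear_combination V 1 * h3 - U 1 * h2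
  · linear_combination V 2 * h3 - U 2 * h2

theorem complete (h : IsONPair U V) (X : E3) :
    X = inner ℝ X U • U + inner ℝ X V • V + inner ℝ X (cross U V) • cross U V := by
  have hc := h.cross_cross
  have hl := cross_left U V
  have hr := cross_right U V
  obtain ⟨h1, h2, h3⟩ := h.coords
  set W := cross U V
  rw [inner_E3] at hc hl hr
  -- The rows are orthonormal; a one-sided inverse of a square matrix is two-sided, so the columns
  -- are orthonormal as well, and this is completeness.
  have hM : (!![U 0, U 1, U 2; V 0, V 1, V 2; W 0, W 1, W 2] : Matrix (Fin 3) (Fin 3) ℝ) *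
      !![U 0, V 0, W 0; U 1, V 1, W 1; U 2, V 2, W 2] = 1 := by
    ext i j
    fin_cases i <;> fin_cases j <;> simp [Matrix.mul_apply, Fin.sum_univ_three] <;> linarith
  rw [mul_eq_one_comm] at hM
  have e := fun i j => congrFun (congrFun hM i) j
  have e00 := e 0 0
  have e01 := e 0 1
  have e02 := e 0 2
  have e11 := e 1 1
  have e12 := e 1 2
  have e22 := e 2 2
  simp [Matrix.mul_apply, Fin.sum_univ_three] at e00 e01 e02 e11 e12 e22
  apply ext_E3 <;> simp only [inner_E3, PiLp.add_apply, PiLp.smul_apply, smul_eq_mul]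
  · linear_combination -X 0 * e00 - X 1 * e01 - X 2 * e02
  · linear_combination -X 0 * e01 - X 1 * e11 - X 2 * e12
  · linear_combination -X 0 * e02 - X 1 * e12 - X 2 * e22

theorem tangentProj_eq (h : IsONPair U V) (X : E3) :
    tangentProj U X = inner ℝ X V • V + inner ℝ X (cross U V) • cross U V := by
  rw [tangentProj, real_inner_comm]
  nth_rw 1 [h.complete X]
  abel

end IsONPair

variable {u : Hyp → S2} {v : ℝ → E3}

theorem inPolar_eq_rot (hu : Equivariant u) (r θ : ℝ) :
    inPolar u r θ = rot θ (profile u r) := by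
  rw [profile, inPolar, inPolar, ← hu]
  congr 2
  apply Subtype.ext
  apply ext_E3 <;> simp [rotHyp, polar, rot_zero_apply, rot_one_apply, rot_two_apply, mul_comm]

theorem inner_profile_self (u : Hyp → S2) (r : ℝ) : inner ℝ (profile u r) (profile u r) = 1 := by
  have : ‖profile u r‖ = 1 := by
    simp [profile, inPolar]
  rw [real_inner_self_eq_norm_sq, this, one_pow]

theorem IsCoulombFrame.isONPair (hv : IsCoulombFrame u v) {r : ℝ} (hr : 0 < r) :
    IsONPair (profile u r) (v r) :=
  ⟨inner_profile_self u r, by rw [real_inner_self_eq_norm_sq, hv.norm_eq_one r hr, one_pow],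
    hv.tangent r hr⟩

theorem isONPair_rot (hu : Equivariant u) (hv : IsCoulombFrame u v) {r : ℝ} (hr : 0 < r)
    (θ : ℝ) : IsONPair (inPolar u r θ) (frameV v r θ) := by
  rw [inPolar_eq_rot hu]
  exact (hv.isONPair hr).rot θ

/-- The radial profile of the frame vector `w`. -/
noncomputable def wBar (u : Hyp → S2) (v : ℝ → E3) (r : ℝ) : E3 := cross (profile u r) (v r)

theorem frameW_eq_rot (hu : Equivariant u) (r θ : ℝ) :
    frameW u v r θ = rot θ (wBar u v r) := by
  rw [frameW, inPolar_eq_rot hu, frameV, cross_rot, wBar]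

/-- The tangent vector with complex coordinate `φ` in the frame `(v, w)`. -/
noncomputable def lift (u : Hyp → S2) (v : ℝ → E3) (φ : ℂ) (r θ : ℝ) : E3 :=
  φ.re • frameV v r θ + φ.im • frameW u v r θ

theorem frameCoord_re (r θ : ℝ) (X : E3) :
    (frameCoord u v r θ X).re = inner ℝ X (frameV v r θ) := by
  simp [frameCoord]

theorem frameCoord_im (r θ : ℝ) (X : E3) :
    (frameCoord u v r θ X).im = inner ℝ X (frameW u v r θ) := by
  simp [frameCoord]

theorem frameCoord_sub (r θ : ℝ) (X Y : E3) :
    frameCoord u v r θ (X - Y) = frameCoord u v r θ X - frameCoord u v r θ Y := by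
  apply Complex.ext <;> simp [frameCoord_re, frameCoord_im, inner_sub_left]

theorem frameCoord_smul (r θ c : ℝ) (X : E3) :
    frameCoord u v r θ (c • X) = c • frameCoord u v r θ X := by
  apply Complex.ext <;> simp [frameCoord_re, frameCoord_im, inner_smul_left]

theorem frameCoord_sum {ι : Type*} (s : Finset ι) (r θ : ℝ) (X : ι → E3) :
    frameCoord u v r θ (∑ i ∈ s, X i) = ∑ i ∈ s, frameCoord u v r θ (X i) := by
  apply Complex.ext <;> simp [frameCoord_re, frameCoord_im, sum_inner]

theorem tangentProj_eq_lift (hu : Equivariant u) (hv : IsCoulombFrame u v) {r : ℝ} (hr : 0 < r)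
    (θ : ℝ) (X : E3) :
    tangentProj (inPolar u r θ) X = lift u v (frameCoord u v r θ X) r θ := by
  rw [(isONPair_rot hu hv hr θ).tangentProj_eq, lift, frameCoord_re, frameCoord_im, frameW]

theorem frameCoord_lift (hu : Equivariant u) (hv : IsCoulombFrame u v) {r : ℝ} (hr : 0 < r)
    (θ : ℝ) (φ : ℂ) : frameCoord u v r θ (lift u v φ r θ) = φ := by
  have h := isONPair_rot hu hv hr θ
  have h1 := h.right
  have h2 := h.cross_cross
  have h3 := IsONPair.cross_right (inPolar u r θ) (frameV v r θ)
  have h4 := h3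
  rw [real_inner_comm] at h4
  apply Complex.ext
  · rw [frameCoord_re, lift, inner_add_left, inner_smul_left, inner_smul_left, frameW, h1, h3]
    simp
  · rw [frameCoord_im, lift, inner_add_left, inner_smul_left, inner_smul_left, frameW, h4, h2]
    simp

theorem norm_lift (hu : Equivariant u) (hv : IsCoulombFrame u v) {r : ℝ} (hr : 0 < r)
    (θ : ℝ) (φ : ℂ) : ‖lift u v φ r θ‖ = ‖φ‖ := by
  have h := isONPair_rot hu hv hr θ
  have h1 := h.right
  have h2 := h.cross_cross
  have h3 := IsONPair.cross_right (inPolar u r θ) (frameV v r θ)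
  have h4 := h3
  rw [real_inner_comm] at h4
  rw [← sq_eq_sq₀ (norm_nonneg _) (norm_nonneg _), ← real_inner_self_eq_norm_sq, lift,
    ← Complex.normSq_eq_norm_sq, Complex.normSq_apply]
  simp only [inner_add_left, inner_add_right, inner_smul_left, inner_smul_right, frameW, h1, h2,
    h3, h4]
  simp

theorem psi1_eq (hu : Equivariant u) (r θ : ℝ) :
    psi1 u v r θ = inner ℝ (deriv (profile u) r) (v r)
      + Complex.I * inner ℝ (deriv (profile u) r) (wBar u v r) := by
  have : (fun s => inPolar u s θ) = fun s => rot θ (profile u s) :=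
    funext fun s => inPolar_eq_rot hu s θ
  rw [psi1, frameCoord, this, deriv_rot, frameV, frameW_eq_rot hu, inner_rot, inner_rot]

theorem deriv_inPolar_angle (hu : Equivariant u) (r θ : ℝ) :
    deriv (fun t => inPolar u r t) θ = rot θ (kCross (profile u r)) := by
  have : (fun t => inPolar u r t) = fun t => rot t (profile u r) :=
    funext fun t => inPolar_eq_rot hu r t
  rw [this, (hasDerivAt_rot _ _).deriv]

/-- Since `∂_θ u = k × u`, the triple product gives `(k × u) · v = k · w` and `(k × u) · w = -k ·
v`. -/
theorem psi2_eq (hu : Equivariant u) (hv : IsCoulombFrame u v) {r : ℝ} (hr : 0 < r) (θ : ℝ) :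
    psi2 u v r θ = (wBar u v r 2 : ℝ) - Complex.I * (v r 2 : ℝ) := by
  obtain ⟨h1, h2, h3⟩ := (hv.isONPair hr).coords
  rw [psi2, frameCoord, deriv_inPolar_angle hu, frameV, frameW_eq_rot hu, inner_rot, inner_rot]
  have e1 : inner ℝ (kCross (profile u r)) (v r) = wBar u v r 2 := by
    simp only [inner_E3, kCross_zero, kCross_one, kCross_two, wBar, cross_two]; ring
  have e2 : inner ℝ (kCross (profile u r)) (wBar u v r) = - v r 2 := by
    simp only [inner_E3, kCross_zero, kCross_one, kCross_two, wBar, cross_zero, cross_one]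
    linear_combination (profile u r 2) * h3 - v r 2 * h1
  rw [e1, e2]; push_cast; ring

end Frames

/-! ### The fields as radial profiles, the structure equations and transfer of regularity -/

section Fields

/-- The cross product as a continuous bilinear map. -/
noncomputable def crossL : E3 →L[ℝ] E3 →L[ℝ] E3 :=
  (LinearMap.mk₂ ℝ cross
    (fun x y z => by
      apply ext_E3 <;> simp only [cross_zero, cross_one, cross_two, PiLp.add_apply] <;> ring)
    (fun c x y => by
      apply ext_E3 <;> simp only [cross_zero, cross_one, cross_two, PiLp.smul_apply, smul_eq_mul]
        <;> ring)
    (fun x y z => by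
      apply ext_E3 <;> simp only [cross_zero, cross_one, cross_two, PiLp.add_apply] <;> ring)
    (fun c x y => by
      apply ext_E3 <;> simp only [cross_zero, cross_one, cross_two, PiLp.smul_apply, smul_eq_mul]
        <;> ring)).toContinuousBilinearMap

theorem crossL_apply (x y : E3) : crossL x y = cross x y := rfl

theorem Reg.cross {n : ℕ} {f g : ℝ → E3} (hf : Reg n f) (hg : Reg n g) :
    Reg n (fun r => cross (f r) (g r)) :=
  Reg.bilin crossL hf hg

theorem Reg.inner {n : ℕ} {f g : ℝ → E3} (hf : Reg n f) (hg : Reg n g) :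
    Reg n (fun r => inner ℝ (f r) (g r)) :=
  Reg.bilin (innerₗ E3).toContinuousBilinearMap hf hg

theorem Reg.coord {n : ℕ} {f : ℝ → E3} (hf : Reg n f) (i : Fin 3) : Reg n (fun r => f r i) :=
  Reg.clm (EuclideanSpace.proj i) hf

theorem Reg.neg {E : Type*} [NormedAddCommGroup E] [NormedSpace ℝ E] {n : ℕ} {f : ℝ → E}
    (hf : Reg n f) : Reg n (fun r => -f r) :=
  Reg.clm (-ContinuousLinearMap.id ℝ E) hf

theorem Reg.mul {n : ℕ} {f g : ℝ → ℂ} (hf : Reg n f) (hg : Reg n g) :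
    Reg n (fun r => f r * g r) :=
  Reg.bilin (ContinuousLinearMap.mul ℝ ℂ) hf hg

theorem Reg.ofReal {n : ℕ} {f : ℝ → ℝ} (hf : Reg n f) : Reg n (fun r => (f r : ℂ)) :=
  Reg.clm Complex.ofRealCLM hf

theorem Reg.re {n : ℕ} {f : ℝ → ℂ} (hf : Reg n f) : Reg n (fun r => (f r).re) :=
  Reg.clm Complex.reCLM hf

theorem Reg.im {n : ℕ} {f : ℝ → ℂ} (hf : Reg n f) : Reg n (fun r => (f r).im) :=
  Reg.clm Complex.imCLM hf

theorem reg_sinh_inv (n : ℕ) : Reg n (fun r => (Real.sinh r)⁻¹) :=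
  Reg.of_contDiffOn n
    (Real.contDiff_sinh.contDiffOn.inv fun _ hr => (Real.sinh_pos_iff.2 hr).ne')

variable {u : Hyp → S2} {v : ℝ → E3}

/-- The radial profile of `ψ₁`. -/
noncomputable def psiR (u : Hyp → S2) (v : ℝ → E3) (r : ℝ) : ℂ := psi1 u v r 0

/-- The radial profile of `i ψ₂`. -/
noncomputable def zetaR (u : Hyp → S2) (v : ℝ → E3) (r : ℝ) : ℂ :=
  (v r 2 : ℝ) + Complex.I * (wBar u v r 2 : ℝ)

/-- The radial profile of `ψ⁺`. -/
noncomputable def plusR (u : Hyp → S2) (v : ℝ → E3) (r : ℝ) : ℂ :=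
  psiR u v r + ((Real.sinh r)⁻¹ : ℝ) * zetaR u v r

/-- The radial profile of `ψ⁻`. -/
noncomputable def minusR (u : Hyp → S2) (v : ℝ → E3) (r : ℝ) : ℂ :=
  psiR u v r - ((Real.sinh r)⁻¹ : ℝ) * zetaR u v r

theorem psi1_eq_psiR (hu : Equivariant u) (r θ : ℝ) : psi1 u v r θ = psiR u v r := by
  rw [psiR, psi1_eq hu, psi1_eq hu]

theorem psi2_eq_zetaR (hu : Equivariant u) (hv : IsCoulombFrame u v) {r : ℝ} (hr : 0 < r)
    (θ : ℝ) : psi2 u v r θ = -Complex.I * zetaR u v r := by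
  rw [psi2_eq hu hv hr, zetaR]
  linear_combination (wBar u v r 2 : ℂ) * Complex.I_sq

theorem psiPlus_eq_plusR (hu : Equivariant u) (hv : IsCoulombFrame u v) {r : ℝ} (hr : 0 < r)
    (θ : ℝ) : psiPlus u v r θ = plusR u v r := by
  rw [psiPlus, plusR, psi1_eq_psiR hu, psi2_eq_zetaR hu hv hr, div_eq_mul_inv]
  push_cast
  linear_combination (-(zetaR u v r * (Complex.sinh r)⁻¹)) * Complex.I_sq

theorem psiMinus_eq_minusR (hu : Equivariant u) (hv : IsCoulombFrame u v) {r : ℝ} (hr : 0 < r)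
    (θ : ℝ) : psiMinus u v r θ = minusR u v r := by
  rw [psiMinus, minusR, psi1_eq_psiR hu, psi2_eq_zetaR hu hv hr, div_eq_mul_inv]
  push_cast
  linear_combination (zetaR u v r * (Complex.sinh r)⁻¹) * Complex.I_sq

theorem psiR_re (hu : Equivariant u) (r : ℝ) :
    (psiR u v r).re = inner ℝ (deriv (profile u) r) (v r) := by
  simp [psiR, psi1_eq hu]

theorem psiR_im (hu : Equivariant u) (r : ℝ) :
    (psiR u v r).im = inner ℝ (deriv (profile u) r) (wBar u v r) := by
  simp [psiR, psi1_eq hu]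

theorem inner_deriv_profile {r : ℝ} (h : DifferentiableAt ℝ (profile u) r) :
    inner ℝ (deriv (profile u) r) (profile u r) = 0 := by
  have h1 := h.hasDerivAt.inner ℝ h.hasDerivAt
  have h2 : (fun t => inner ℝ (profile u t) (profile u t)) = fun _ => (1 : ℝ) :=
    funext fun t => inner_profile_self u t
  rw [h2] at h1
  have h3 := h1.unique (hasDerivAt_const r (1 : ℝ))
  rw [real_inner_comm (deriv (profile u) r) (profile u r)] at h3
  linarith

theorem deriv_profile_eq (hu : Equivariant u) (hv : IsCoulombFrame u v) {r : ℝ} (hr : 0 < r)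
    (h : DifferentiableAt ℝ (profile u) r) :
    deriv (profile u) r = (psiR u v r).re • v r + (psiR u v r).im • wBar u v r := by
  rw [psiR_re hu, psiR_im hu]
  nth_rw 1 [(hv.isONPair hr).complete (deriv (profile u) r)]
  rw [inner_deriv_profile h, zero_smul, zero_add, wBar]

theorem coulomb_ode_rhs (hu : Equivariant u) (r : ℝ) :
    -(inner ℝ (v r) (deriv (profile u) r) • profile u r) = -((psiR u v r).re • profile u r) := by
  rw [psiR_re hu, real_inner_comm]

/-- The structure equations of the Coulomb frame. -/
structure FrameEquations (u : Hyp → S2) (v : ℝ → E3) : Prop where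
  deriv_profile : ∀ r, 0 < r → HasDerivAt (profile u)
    ((psiR u v r).re • v r + (psiR u v r).im • wBar u v r) r
  deriv_v : ∀ r, 0 < r → HasDerivAt v (-((psiR u v r).re • profile u r)) r
  deriv_w : ∀ r, 0 < r → HasDerivAt (wBar u v) (-((psiR u v r).im • profile u r)) r

/-- With a continuous `∂_r ū` the frame equation holds everywhere. The equation for `w̄` is the
product rule for `ū × v̄`, using `w̄ × v̄ = -ū`. -/
theorem frameEquations (hu : Equivariant u) (hv : IsCoulombFrame u v) (h : Reg 1 (profile u)) :
    FrameEquations u v := by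
  have h0 := h.of_succ
  obtain ⟨U', hU, hU'⟩ := h
  have hp : ∀ r, 0 < r → HasDerivAt (profile u)
      ((psiR u v r).re • v r + (psiR u v r).im • wBar u v r) r := fun r hr => by
    rw [← deriv_profile_eq hu hv hr (hU r hr).differentiableAt]
    exact (hU r hr).differentiableAt.hasDerivAt
  have hd : Reg 0 (deriv (profile u)) := Reg.congr hU' fun r hr => (hU r hr).deriv.symm
  have hV : ∀ r, 0 < r → HasDerivAt v (-((psiR u v r).re • profile u r)) r := by
    intro r hr
    rw [← coulomb_ode_rhs hu]
    exact LAC.hasDerivAt_of_ae hv.absCont hv.ode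
      (Reg.neg (((Reg.inner (n := 0) hv.absCont hd)).smul h0)).lac.continuousOn r hr
  refine ⟨hp, hV, fun r hr => ?_⟩
  have hW := (crossL.hasFDerivAt.comp_hasDerivAt r (hp r hr)).clm_apply (hV r hr)
  refine hW.congr_deriv ?_
  have e := (hv.isONPair hr).cross_cross_right
  rw [← wBar] at e
  have e2 : cross (v r) (v r) = 0 := by
    apply ext_E3 <;> simp only [cross_zero, cross_one, cross_two, PiLp.zero_apply] <;> ring
  have e3 : cross (profile u r) (profile u r) = 0 := by
    apply ext_E3 <;> simp only [cross_zero, cross_one, cross_two, PiLp.zero_apply] <;> ring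
  simp only [Function.comp_apply, map_add, map_smul, map_neg, add_apply, smul_apply,
    crossL_apply, e, e2, e3]
  simp

theorem reg_psi_of_reg_profile (hu : Equivariant u) (hv : IsCoulombFrame u v)
    (h : Reg 2 (profile u)) : Reg 1 (plusR u v) ∧ Reg 1 (minusR u v) := by
  have hode := frameEquations hu hv h.of_succ
  have h1 := h.of_succ
  obtain ⟨U', hU, hU'⟩ := h
  have hd : Reg 1 (deriv (profile u)) := Reg.congr hU' fun r hr => (hU r hr).deriv.symm
  have hV : Reg 1 v := by
    refine ⟨_, fun r hr => ?_,
      (((Reg.inner (n := 0) hv.absCont hd.of_succ)).smul h1.of_succ).neg⟩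
    rw [coulomb_ode_rhs hu]
    exact hode.deriv_v r hr
  have hW : Reg 1 (wBar u v) := h1.cross hV
  have hp : Reg 1 (psiR u v) :=
    ((hd.inner hV).ofReal.add ((Reg.const 1 Complex.I).mul (hd.inner hW).ofReal)).congr
      fun r _ => (psi1_eq hu r 0).symm
  have hz : Reg 1 (zetaR u v) :=
    (hV.coord 2).ofReal.add ((Reg.const 1 Complex.I).mul (hW.coord 2).ofReal)
  have hz2 := (reg_sinh_inv 1).ofReal.mul hz
  exact ⟨hp.add hz2, (hp.add hz2.neg).congr fun r _ => by rw [minusR, sub_eq_add_neg]⟩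

/-- A bootstrap: `∂_r ū = Re ψ₁ v̄ + Im ψ₁ w̄` holds almost everywhere with an absolutely continuous
right side, which gives one classical derivative of `ū`. The structure equations then give one for
`v̄` and `w̄`, and the same formula gives the next one for `ū`. -/
theorem reg_profile_of_reg_psi (hu : Equivariant u) (hv : IsCoulombFrame u v)
    (h : LAC (profile u)) (h1 : Reg 1 (plusR u v)) (h2 : Reg 1 (minusR u v)) :
    Reg 2 (profile u) := by
  have h0 : Reg 0 (profile u) := h
  have hp : Reg 1 (psiR u v) := by
    refine ((Reg.const 1 (1 / 2 : ℂ)).mul (h1.add h2)).congr fun r _ => ?_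
    rw [plusR, minusR]; ring
  have hV0 : Reg 0 v := hv.absCont
  have hW0 : Reg 0 (wBar u v) := h0.cross hV0
  have hR : Reg 0 (fun r => (psiR u v r).re • v r + (psiR u v r).im • wBar u v r) :=
    (hp.of_succ.re.smul hV0).add (hp.of_succ.im.smul hW0)
  have hU : Reg 1 (profile u) := by
    refine ⟨_, fun r hr => h.hasDerivAt_of_ae ?_ hR.lac.continuousOn r hr, hR⟩
    filter_upwards [h.ae_differentiableAt, ae_restrict_mem measurableSet_Ioi] with r hd hr
    rw [← deriv_profile_eq hu hv hr hd]
    exact hd.hasDerivAt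
  have hode := frameEquations hu hv hU
  have hV : Reg 1 v := ⟨_, hode.deriv_v, (hp.of_succ.re.smul h0).neg⟩
  have hW : Reg 1 (wBar u v) := hU.cross hV
  exact ⟨_, hode.deriv_profile, (hp.re.smul hV).add (hp.im.smul hW)⟩

theorem forall_sobolevLoc_inPolar_iff (hu : Equivariant u) (n : ℕ) :
    (∀ θ, SobolevLoc (n + 1) (fun r => inPolar u r θ)) ↔ Reg n (profile u) := by
  simp only [← reg_iff_sobolevLoc]
  refine ⟨fun h => h 0, fun h θ => ?_⟩
  exact (Reg.clm (rotEquiv θ : E3 →L[ℝ] E3) h).congr fun r _ => (inPolar_eq_rot hu r θ).symm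

theorem forall_sobolevLoc_RPlus_iff (hu : Equivariant u) (hv : IsCoulombFrame u v) :
    (∀ θ, SobolevLoc 2 (fun r => RPlus (psiPlus u v) r θ)) ↔ Reg 1 (plusR u v) := by
  simp only [← reg_iff_sobolevLoc]
  refine ⟨fun h => (h 0).congr fun r hr => ?_, fun h θ => ?_⟩
  · rw [RPlus, psiPlus_eq_plusR hu hv hr]; simp
  · exact ((Reg.const 1 _).mul h).congr fun r hr => by
      rw [RPlus, psiPlus_eq_plusR hu hv hr]

theorem forall_sobolevLoc_RMinus_iff (hu : Equivariant u) (hv : IsCoulombFrame u v) :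
    (∀ θ, SobolevLoc 2 (fun r => RMinus (psiMinus u v) r θ)) ↔ Reg 1 (minusR u v) := by
  simp only [← reg_iff_sobolevLoc]
  refine ⟨fun h => (h 0).congr fun r hr => ?_, fun h θ => h.congr fun r hr => ?_⟩
  · rw [RMinus, psiMinus_eq_minusR hu hv hr]
  · rw [RMinus, psiMinus_eq_minusR hu hv hr]

end Fields

/-! ### Covariant derivatives as radial operators -/

section RadialTensors

/-- The covariant derivative in radial form: the angular derivative is multiplication by `i κ`. -/
noncomputable def radCov {n : ℕ} (κ : ℝ → ℝ) (Φ : (Fin n → Fin 2) → ℝ → ℂ)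
    (I : Fin (n + 1) → Fin 2) (r : ℝ) : ℂ :=
  (if I 0 = 0 then deriv (Φ (Fin.tail I)) r
    else ((Real.sinh r)⁻¹ : ℝ) • (Complex.I * κ r * Φ (Fin.tail I) r))
    - ∑ a : Fin n, ∑ l : Fin 2,
        conn r (I 0) (Fin.tail I a) l • Φ (Function.update (Fin.tail I) a l) r

variable {u : Hyp → S2} {v : ℝ → E3}

/-- The derivatives of `v` and `w` are normal to the sphere, so after projection only the derivative
of the coordinate survives. This is the gain from the Coulomb gauge. -/
theorem FrameEquations.hasDerivAt_lift (hu : Equivariant u) (hf : FrameEquations u v)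
    {φ : ℝ → ℂ} {r : ℝ} (hr : 0 < r) (hφ : DifferentiableAt ℝ φ r) (θ : ℝ) :
    HasDerivAt (fun s => lift u v (φ s) s θ) (lift u v (deriv φ r) r θ
      - ((φ r).re * (psiR u v r).re + (φ r).im * (psiR u v r).im) • inPolar u r θ) r := by
  have e : (fun s => lift u v (φ s) s θ)
      = fun s => rotEquiv θ ((φ s).re • v s + (φ s).im • wBar u v s) := by
    funext s
    simp [lift, frameW_eq_rot hu, frameV, ← rotEquiv_apply]
  have h1 : HasDerivAt (fun s => (φ s).re) (deriv φ r).re r :=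
    Complex.reCLM.hasFDerivAt.comp_hasDerivAt r hφ.hasDerivAt
  have h2 : HasDerivAt (fun s => (φ s).im) (deriv φ r).im r :=
    Complex.imCLM.hasFDerivAt.comp_hasDerivAt r hφ.hasDerivAt
  rw [e]
  refine ((rotEquiv θ).hasFDerivAt.comp_hasDerivAt r
    ((h1.smul (hf.deriv_v r hr)).add (h2.smul (hf.deriv_w r hr)))).congr_deriv ?_
  rw [lift, frameW_eq_rot hu, frameV, inPolar_eq_rot hu, ← rotEquiv_apply, ← rotEquiv_apply,
    ← rotEquiv_apply]
  simp only [ContinuousLinearEquiv.coe_coe, map_add, map_smul, map_neg]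
  module

theorem frameCoord_inPolar (hu : Equivariant u) (hv : IsCoulombFrame u v) {r : ℝ} (hr : 0 < r)
    (θ : ℝ) : frameCoord u v r θ (inPolar u r θ) = 0 := by
  have h := isONPair_rot hu hv hr θ
  apply Complex.ext
  · rw [frameCoord_re, real_inner_comm, h.orth, Complex.zero_re]
  · rw [frameCoord_im, real_inner_comm, frameW, IsONPair.cross_left, Complex.zero_im]

/-- The tangential part of `X ↦ k × X` is the rotation by a right angle in the tangent plane times
the height `u₃ = k · u`. -/
theorem frameCoord_deriv_angle (hu : Equivariant u) (hv : IsCoulombFrame u v) {r : ℝ}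
    (hr : 0 < r) (φ : ℂ) (θ : ℝ) :
    frameCoord u v r θ (deriv (fun t => lift u v φ r t) θ)
      = Complex.I * (profile u r 2 : ℝ) * φ := by
  obtain ⟨h1, h2, h3⟩ := (hv.isONPair hr).coords
  have e : (fun t => lift u v φ r t) = fun t => rot t (φ.re • v r + φ.im • wBar u v r) := by
    funext s
    simp [lift, frameW_eq_rot hu, frameV, ← rotEquiv_apply]
  have e1 : inner ℝ (kCross (φ.re • v r + φ.im • wBar u v r)) (v r)
      = -(profile u r 2 * φ.im) := by
    simp only [inner_E3, kCross_zero, kCross_one, kCross_two, wBar, cross_zero, cross_one,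
      PiLp.add_apply, PiLp.smul_apply, smul_eq_mul]
    linear_combination φ.im * (v r 2 * h3 - profile u r 2 * h2)
  have e2 : inner ℝ (kCross (φ.re • v r + φ.im • wBar u v r)) (wBar u v r)
      = profile u r 2 * φ.re := by
    simp only [inner_E3, kCross_zero, kCross_one, kCross_two, wBar, cross_zero, cross_one,
      PiLp.add_apply, PiLp.smul_apply, smul_eq_mul]
    linear_combination φ.re * (profile u r 2 * h2 - v r 2 * h3)
  rw [e, (hasDerivAt_rot _ _).deriv]
  apply Complex.ext
  · rw [frameCoord_re, frameV, inner_rot, e1]; simp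
  · rw [frameCoord_im, frameW_eq_rot hu, inner_rot, e2]; simp

/-- The inductive step that turns `∇^i du` into an iterated `radCov` with multiplier `u₃`.
Differentiability is needed only at the point `r`, so the last derivative may be taken almost
everywhere. -/
theorem tangentProj_covDeriv (hu : Equivariant u) (hv : IsCoulombFrame u v)
    (hf : FrameEquations u v) {n : ℕ} {T : (Fin n → Fin 2) → ℝ → ℝ → E3}
    {Φ : (Fin n → Fin 2) → ℝ → ℂ} (hT : ∀ J s θ, 0 < s → T J s θ = lift u v (Φ J s) s θ)
    {r : ℝ} (hr : 0 < r) (hΦ : ∀ J, DifferentiableAt ℝ (Φ J) r) (I : Fin (n + 1) → Fin 2)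
    (θ : ℝ) :
    tangentProj (inPolar u r θ) (covDeriv T I r θ)
      = lift u v (radCov (fun s => profile u s 2) Φ I r) r θ := by
  rw [tangentProj_eq_lift hu hv hr]
  congr 1
  rw [covDeriv, radCov, frameCoord_sub, frameCoord_sum]
  congr 1
  · rw [frameDeriv]
    split_ifs with h0
    · have : (fun s => T (Fin.tail I) s θ)
          =ᶠ[𝓝 r] fun s => lift u v (Φ (Fin.tail I) s) s θ := by
        filter_upwards [Ioi_mem_nhds hr] with s hs using hT _ _ _ hs
      rw [this.deriv_eq, (hf.hasDerivAt_lift hu hr (hΦ _) θ).deriv, frameCoord_sub,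
        frameCoord_smul, frameCoord_inPolar hu hv hr, frameCoord_lift hu hv hr, smul_zero,
        sub_zero]
    · have : (fun t => T (Fin.tail I) r t) = fun t => lift u v (Φ (Fin.tail I) r) r t :=
        funext fun t => hT _ _ _ hr
      rw [this, frameCoord_smul, frameCoord_deriv_angle hu hv hr]
  · refine Finset.sum_congr rfl fun a _ => ?_
    rw [frameCoord_sum]
    refine Finset.sum_congr rfl fun l _ => ?_
    rw [frameCoord_smul, hT _ _ _ hr, frameCoord_lift hu hv hr]

/-- The components of `du` in the Coulomb frame. -/
noncomputable def duR (u : Hyp → S2) (v : ℝ → E3) (I : Fin 1 → Fin 2) (r : ℝ) : ℂ :=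
  if I 0 = 0 then psiR u v r else -Complex.I * (((Real.sinh r)⁻¹ : ℝ) * zetaR u v r)

theorem iterCovMap_zero_eq_lift (hu : Equivariant u) (hv : IsCoulombFrame u v)
    (hf : FrameEquations u v) (I : Fin 1 → Fin 2) (r θ : ℝ) (hr : 0 < r) :
    iterCovMap (inPolar u) 0 I r θ = lift u v (duR u v I r) r θ := by
  have h : iterCovMap (inPolar u) 0 I r θ = frameDeriv (I 0) (inPolar u) r θ := by
    simp [iterCovMap, covDeriv]
  rw [h, frameDeriv, duR]
  split_ifs with h0
  · have : (fun s => inPolar u s θ) = fun s => rot θ (profile u s) :=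
      funext fun s => inPolar_eq_rot hu s θ
    rw [this, deriv_rot, (hf.deriv_profile r hr).deriv, lift, frameW_eq_rot hu, frameV,
      ← rotEquiv_apply, ← rotEquiv_apply, ← rotEquiv_apply]
    simp
  · have ht : tangentProj (inPolar u r θ) (deriv (fun t => inPolar u r t) θ)
        = deriv (fun t => inPolar u r t) θ := by
      have : inner ℝ (inPolar u r θ) (deriv (fun t => inPolar u r t) θ) = 0 := by
        rw [deriv_inPolar_angle hu, inPolar_eq_rot hu, inner_rot, inner_E3, kCross_zero,
          kCross_one, kCross_two]
        ring
      rw [tangentProj, this, zero_smul, sub_zero]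
    rw [← ht, tangentProj_eq_lift hu hv hr]
    have e : frameCoord u v r θ (deriv (fun t => inPolar u r t) θ)
        = -Complex.I * zetaR u v r := by
      rw [← psi2_eq_zetaR hu hv hr θ]; rfl
    rw [e]
    have e2 : -Complex.I * (((Real.sinh r)⁻¹ : ℝ) * zetaR u v r)
        = ((Real.sinh r)⁻¹ : ℝ) • (-Complex.I * zetaR u v r) := by
      rw [Complex.real_smul]; ring
    rw [e2]
    simp only [lift, Complex.smul_re, Complex.smul_im, smul_add, smul_smul, smul_eq_mul]

/-- The counterpart for functions: on the angular mode `e^{imθ}` the height is replaced by the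
constant `m`. -/
theorem covDeriv_exp_mul {m : ℝ} {n : ℕ} {T : (Fin n → Fin 2) → ℝ → ℝ → ℂ}
    {Φ : (Fin n → Fin 2) → ℝ → ℂ}
    (hT : ∀ J s θ, 0 < s → T J s θ = Complex.exp (m * Complex.I * (θ : ℂ)) * Φ J s)
    (I : Fin (n + 1) → Fin 2) (r θ : ℝ) (hr : 0 < r) :
    covDeriv T I r θ = Complex.exp (m * Complex.I * (θ : ℂ)) * radCov (fun _ => m) Φ I r := by
  rw [covDeriv, radCov, mul_sub, Finset.mul_sum]
  congr 1
  · rw [frameDeriv]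
    split_ifs with h0
    · have : (fun s => T (Fin.tail I) s θ)
          =ᶠ[𝓝 r] fun s => Complex.exp (m * Complex.I * (θ : ℂ)) * Φ (Fin.tail I) s := by
        filter_upwards [Ioi_mem_nhds hr] with s hs using hT _ _ _ hs
      rw [this.deriv_eq, deriv_const_mul_field]
    · have : (fun t => T (Fin.tail I) r t)
          = fun t : ℝ => Complex.exp (m * Complex.I * (t : ℂ)) * Φ (Fin.tail I) r :=
        funext fun t => hT _ _ _ hr
      have hd : HasDerivAt (fun t : ℝ => Complex.exp (m * Complex.I * (t : ℂ)))
          (Complex.exp (m * Complex.I * (θ : ℂ)) * (m * Complex.I * 1)) θ :=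
        ((Complex.ofRealCLM.hasDerivAt (x := θ)).const_mul (m * Complex.I)).cexp
      rw [this, (hd.mul_const _).deriv]
      simp only [Complex.real_smul]
      ring
  · refine Finset.sum_congr rfl fun a _ => ?_
    rw [Finset.mul_sum]
    refine Finset.sum_congr rfl fun l _ => ?_
    rw [hT _ _ _ hr]
    simp only [Complex.real_smul]
    ring

theorem aemeasurable_radCov {n : ℕ} {κ : ℝ → ℝ} {Φ : (Fin n → Fin 2) → ℝ → ℂ} {μ : Measure ℝ}
    (hκ : AEMeasurable κ μ) (hΦ : ∀ J, AEMeasurable (Φ J) μ) (I : Fin (n + 1) → Fin 2) :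
    AEMeasurable (radCov κ Φ I) μ := by
  have hs : Measurable Real.sinh := Real.continuous_sinh.measurable
  have hc : Measurable Real.cosh := Real.continuous_cosh.measurable
  have hcn : ∀ j i l, Measurable fun r => conn r j i l := by
    intro j i l
    unfold conn
    split_ifs
    · exact hc.div hs
    · exact (hc.div hs).neg
    · exact measurable_const
  unfold radCov
  refine AEMeasurable.sub ?_ (Finset.aemeasurable_fun_sum _ fun a _ =>
    Finset.aemeasurable_fun_sum _ fun l _ => (hcn _ _ _).aemeasurable.smul (hΦ _))
  split_ifs
  · exact (measurable_deriv _).aemeasurable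
  · exact hs.inv.aemeasurable.smul ((aemeasurable_const.mul
      (Complex.measurable_ofReal.comp_aemeasurable hκ)).mul (hΦ _))

end RadialTensors

/-! ### Frame components, and the reduction of `|∇^i du|²` to scalar densities of `ψ⁺` and `ψ⁻` -/

section Components

theorem sum_cons {n : ℕ} {M : Type*} [AddCommMonoid M] (F : (Fin (n + 1) → Fin 2) → M) :
    ∑ I, F I = ∑ J, F (Matrix.vecCons 0 J) + ∑ J, F (Matrix.vecCons 1 J) := by
  rw [← (Fin.consEquiv (fun _ : Fin (n + 1) => Fin 2)).sum_comp, Fintype.sum_prod_type,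
    Fin.sum_univ_two]
  rfl

theorem sum_rank_one {M : Type*} [AddCommMonoid M] (F : (Fin 1 → Fin 2) → M) :
    ∑ I, F I = F ![0] + F ![1] := by
  rw [sum_cons]; simp only [Finset.univ_unique, Finset.sum_singleton]; rfl

theorem sum_rank_two {M : Type*} [AddCommMonoid M] (F : (Fin 2 → Fin 2) → M) :
    ∑ I, F I = (F ![0, 0] + F ![0, 1]) + (F ![1, 0] + F ![1, 1]) := by
  rw [sum_cons, sum_rank_one, sum_rank_one]

theorem sum_rank_three {M : Type*} [AddCommMonoid M] (F : (Fin 3 → Fin 2) → M) :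
    ∑ I, F I = ((F ![0, 0, 0] + F ![0, 0, 1]) + (F ![0, 1, 0] + F ![0, 1, 1])) +
      ((F ![1, 0, 0] + F ![1, 0, 1]) + (F ![1, 1, 0] + F ![1, 1, 1])) := by
  rw [sum_cons, sum_rank_two, sum_rank_two]

/-- The hyperbolic cosecant. -/
noncomputable def csch (r : ℝ) : ℝ := (Real.sinh r)⁻¹

/-- The hyperbolic cotangent. -/
noncomputable def coth (r : ℝ) : ℝ := Real.cosh r / Real.sinh r

theorem conn_zero (r : ℝ) (i l : Fin 2) : conn r 0 i l = 0 := by simp [conn]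

theorem conn_one_zero_zero (r : ℝ) : conn r 1 0 0 = 0 := by simp [conn]

theorem conn_one_zero_one (r : ℝ) : conn r 1 0 1 = coth r := by simp [conn, coth]

theorem conn_one_one_zero (r : ℝ) : conn r 1 1 0 = -coth r := by simp [conn, coth]

theorem conn_one_one_one (r : ℝ) : conn r 1 1 1 = 0 := by simp [conn]

variable (κ : ℝ → ℝ)

theorem radCov_cons_zero {n : ℕ} (Φ : (Fin n → Fin 2) → ℝ → ℂ) (J : Fin n → Fin 2) (r : ℝ) :
    radCov κ Φ (Matrix.vecCons 0 J) r = deriv (Φ J) r := by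
  have e : Fin.tail (Matrix.vecCons 0 J) = J := rfl
  simp [radCov, conn_zero, e]

theorem radCov_one_scalar (Φ : (Fin 0 → Fin 2) → ℝ → ℂ) (r : ℝ) :
    radCov κ Φ ![1] r = Complex.I * ((csch r * κ r : ℝ) * Φ ![] r) := by
  have e : Fin.tail ![(1 : Fin 2)] = ![] := rfl
  simp only [radCov, e, Matrix.cons_val_zero, one_ne_zero, if_false, Finset.univ_eq_empty,
    Finset.sum_empty, sub_zero, Complex.real_smul, csch]
  push_cast; ring

theorem update_single (i l : Fin 2) : Function.update ![i] 0 l = ![l] := by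
  funext a; fin_cases a; rfl

theorem update_pair_zero (i j l : Fin 2) : Function.update ![i, j] 0 l = ![l, j] := by
  funext a; fin_cases a <;> rfl

theorem update_pair_one (i j l : Fin 2) : Function.update ![i, j] 1 l = ![i, l] := by
  funext a; fin_cases a <;> rfl

theorem radCov_one_vector (Φ : (Fin 1 → Fin 2) → ℝ → ℂ) (j : Fin 2) (r : ℝ) :
    radCov κ Φ ![1, j] r = Complex.I * ((csch r * κ r : ℝ) * Φ ![j] r)
      - ((conn r 1 j 0 : ℝ) * Φ ![0] r + (conn r 1 j 1 : ℝ) * Φ ![1] r) := by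
  have e : Fin.tail ![(1 : Fin 2), j] = ![j] := rfl
  simp only [radCov, e, Matrix.cons_val_zero, one_ne_zero, if_false, Fin.sum_univ_two,
    Complex.real_smul, csch, Finset.univ_unique, Finset.sum_singleton, Fin.default_eq_zero,
    update_single]
  push_cast; ring

theorem radCov_one_tensor (Φ : (Fin 2 → Fin 2) → ℝ → ℂ) (j k : Fin 2) (r : ℝ) :
    radCov κ Φ ![1, j, k] r = Complex.I * ((csch r * κ r : ℝ) * Φ ![j, k] r)
      - ((conn r 1 j 0 : ℝ) * Φ ![0, k] r + (conn r 1 j 1 : ℝ) * Φ ![1, k] r)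
      - ((conn r 1 k 0 : ℝ) * Φ ![j, 0] r + (conn r 1 k 1 : ℝ) * Φ ![j, 1] r) := by
  have e : Fin.tail ![(1 : Fin 2), j, k] = ![j, k] := rfl
  simp only [radCov, e, Matrix.cons_val_zero, one_ne_zero, if_false, Fin.sum_univ_two,
    Complex.real_smul, csch, update_pair_zero, update_pair_one, Matrix.cons_val_one]
  push_cast; ring

/-- The squared first derivative of a field of radial profile `ψ` and angular multiplier `μ`. -/
noncomputable def density1 (μ : ℝ → ℝ) (ψ : ℝ → ℂ) (r : ℝ) : ℝ :=
  ‖deriv ψ r‖ ^ 2 + ‖(μ r : ℂ) * ψ r‖ ^ 2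

/-- The squared second derivative of a field of radial profile `ψ` and angular multiplier `μ`. -/
noncomputable def density2 (μ : ℝ → ℝ) (ψ : ℝ → ℂ) (r : ℝ) : ℝ :=
  (‖deriv (deriv ψ) r‖ ^ 2 + ‖deriv (fun s => (μ s : ℂ) * ψ s) r‖ ^ 2) +
    (‖(μ r : ℂ) * deriv ψ r - coth r * (μ r * ψ r)‖ ^ 2
      + ‖coth r * deriv ψ r - (μ r : ℂ) ^ 2 * ψ r‖ ^ 2)

/-- The iterated radial covariant derivatives of a function. -/
noncomputable def funR (m : ℝ) (ψ : ℝ → ℂ) : (l : ℕ) → (Fin l → Fin 2) → ℝ → ℂ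
  | 0 => fun _ => ψ
  | l + 1 => radCov (fun _ => m) (funR m ψ l)

theorem sum_funR_zero (m : ℝ) (ψ : ℝ → ℂ) (r : ℝ) :
    ∑ I, ‖funR m ψ 0 I r‖ ^ 2 = ‖ψ r‖ ^ 2 := by
  simp [funR]

theorem funR_one_zero (m : ℝ) (ψ : ℝ → ℂ) : funR m ψ 1 ![0] = deriv ψ :=
  funext fun _ => radCov_cons_zero _ _ _ _

theorem funR_one_one (m : ℝ) (ψ : ℝ → ℂ) :
    funR m ψ 1 ![1] = fun r => Complex.I * ((csch r * m : ℝ) * ψ r) :=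
  funext fun _ => radCov_one_scalar _ _ _

theorem sum_funR_one (m : ℝ) (ψ : ℝ → ℂ) (r : ℝ) :
    ∑ I, ‖funR m ψ 1 I r‖ ^ 2 = density1 (fun s => csch s * m) ψ r := by
  rw [sum_rank_one, funR_one_zero, funR_one_one, density1, norm_mul Complex.I, Complex.norm_I,
    one_mul]

theorem sum_funR_two (m : ℝ) (ψ : ℝ → ℂ) (r : ℝ) :
    ∑ I, ‖funR m ψ 2 I r‖ ^ 2 = density2 (fun s => csch s * m) ψ r := by
  rw [sum_rank_two, density2]
  have e : funR m ψ 2 = radCov (fun _ => m) (funR m ψ 1) := rfl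
  have h1 : funR m ψ 2 ![0, 1] r
      = Complex.I * deriv (fun s => ((csch s * m : ℝ) : ℂ) * ψ s) r := by
    rw [e, radCov_cons_zero, funR_one_one, deriv_const_mul_field]
  have h2 : funR m ψ 2 ![1, 0] r = Complex.I *
      (((csch r * m : ℝ) : ℂ) * deriv ψ r - coth r * ((csch r * m : ℝ) * ψ r)) := by
    rw [e, radCov_one_vector, conn_one_zero_zero, conn_one_zero_one, funR_one_zero, funR_one_one]
    push_cast; ring
  have h3 : funR m ψ 2 ![1, 1] r
      = coth r * deriv ψ r - ((csch r * m : ℝ) : ℂ) ^ 2 * ψ r := by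
    rw [e, radCov_one_vector, conn_one_one_zero, conn_one_one_one, funR_one_zero, funR_one_one]
    push_cast
    linear_combination (csch r * m : ℂ) ^ 2 * ψ r * Complex.I_sq
  rw [h1, h2, h3, e, radCov_cons_zero, funR_one_zero, norm_mul Complex.I, norm_mul Complex.I,
    Complex.norm_I, one_mul, one_mul]

theorem parallelogram_I (x y : ℂ) :
    ‖x‖ ^ 2 + ‖y‖ ^ 2 = (‖x + Complex.I * y‖ ^ 2 + ‖x - Complex.I * y‖ ^ 2) / 2 := by
  simp only [← Complex.normSq_eq_norm_sq, Complex.normSq_apply, Complex.add_re, Complex.add_im,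
    Complex.sub_re, Complex.sub_im, Complex.mul_re, Complex.mul_im, Complex.I_re, Complex.I_im]
  ring

variable (A B : ℝ → ℂ)

/-- A one-form with radial component `A` and angular component `-i B`. -/
noncomputable def oneForm (I : Fin 1 → Fin 2) (r : ℝ) : ℂ :=
  if I 0 = 0 then A r else -Complex.I * B r

theorem oneForm_zero : oneForm A B ![0] = A := by
  funext r; simp [oneForm]

theorem oneForm_one : oneForm A B ![1] = fun r => -Complex.I * B r := by
  funext r; simp [oneForm]

theorem sum_oneForm (r : ℝ) :
    ∑ I, ‖oneForm A B I r‖ ^ 2 = (‖A r + B r‖ ^ 2 + ‖A r - B r‖ ^ 2) / 2 := by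
  rw [sum_rank_one, oneForm_zero, oneForm_one, parallelogram_I]
  have : Complex.I * (-Complex.I * B r) = B r := by linear_combination (-B r) * Complex.I_sq
  rw [this]

theorem radCov_oneForm_zero_zero (r : ℝ) :
    radCov κ (oneForm A B) ![0, 0] r = deriv A r := by
  rw [radCov_cons_zero, oneForm_zero]

theorem radCov_oneForm_zero_one (r : ℝ) :
    radCov κ (oneForm A B) ![0, 1] r = -Complex.I * deriv B r := by
  rw [radCov_cons_zero, oneForm_one, deriv_const_mul_field]

theorem radCov_oneForm_one_zero (r : ℝ) :
    radCov κ (oneForm A B) ![1, 0] r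
      = Complex.I * ((csch r * κ r : ℝ) * A r + coth r * B r) := by
  rw [radCov_one_vector, conn_one_zero_zero, conn_one_zero_one, oneForm_zero, oneForm_one]
  push_cast; ring

theorem radCov_oneForm_one_one (r : ℝ) :
    radCov κ (oneForm A B) ![1, 1] r = (csch r * κ r : ℝ) * B r + coth r * A r := by
  rw [radCov_one_vector, conn_one_one_zero, conn_one_one_one, oneForm_zero, oneForm_one]
  push_cast
  linear_combination (-(csch r * κ r * B r : ℂ)) * Complex.I_sq

variable {A B}

/-- Passing to `x ± i y` in the slot of `du` diagonalizes the connection on covectors: the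
Christoffel term becomes `± coth` in the multiplier, and `A ± B` evolve independently. -/
theorem sum_radCov_oneForm {r : ℝ} (hA : DifferentiableAt ℝ A r) (hB : DifferentiableAt ℝ B r) :
    ∑ I, ‖radCov κ (oneForm A B) I r‖ ^ 2
      = (density1 (fun s => csch s * κ s + coth s) (fun s => A s + B s) r
        + density1 (fun s => csch s * κ s - coth s) (fun s => A s - B s) r) / 2 := by
  rw [sum_rank_two, parallelogram_I, parallelogram_I (radCov κ (oneForm A B) ![1, 0] r),
    radCov_oneForm_zero_zero, radCov_oneForm_zero_one, radCov_oneForm_one_zero,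
    radCov_oneForm_one_one, density1, density1, deriv_fun_add hA hB, deriv_fun_sub hA hB]
  have e1 : Complex.I * (-Complex.I * deriv B r) = deriv B r := by
    linear_combination (-deriv B r) * Complex.I_sq
  have e2 : Complex.I * ((csch r * κ r : ℝ) * A r + coth r * B r)
      + Complex.I * ((csch r * κ r : ℝ) * B r + coth r * A r)
      = Complex.I * (((csch r * κ r + coth r : ℝ) : ℂ) * (A r + B r)) := by
    push_cast; ring
  have e3 : Complex.I * ((csch r * κ r : ℝ) * A r + coth r * B r)
      - Complex.I * ((csch r * κ r : ℝ) * B r + coth r * A r)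
      = Complex.I * (((csch r * κ r - coth r : ℝ) : ℂ) * (A r - B r)) := by
    push_cast; ring
  rw [e1, e2, e3, norm_mul Complex.I, norm_mul Complex.I, Complex.norm_I, one_mul, one_mul]
  ring

theorem hasDerivAt_csch {r : ℝ} (hr : 0 < r) : HasDerivAt csch (-(coth r * csch r)) r := by
  have hs := (Real.sinh_pos_iff.2 hr).ne'
  refine ((Real.hasDerivAt_sinh r).inv hs).congr_deriv ?_
  rw [coth, csch]; field_simp

theorem hasDerivAt_coth {r : ℝ} (hr : 0 < r) : HasDerivAt coth (-csch r ^ 2) r := by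
  have hs := (Real.sinh_pos_iff.2 hr).ne'
  refine ((Real.hasDerivAt_cosh r).div (Real.hasDerivAt_sinh r) hs).congr_deriv ?_
  rw [csch]; field_simp
  linarith [Real.cosh_sq_sub_sinh_sq r]

variable {κ}

/-- The same diagonalization in the last slot, for each value of the two derivative slots. The
remaining Christoffel terms, from the first derivative slot, are those of the Hessian of a function,
hence `density2`. -/
theorem sum_radCov_radCov_oneForm {r : ℝ} (hr : 0 < r)
    (hA : ∀ s, 0 < s → DifferentiableAt ℝ A s) (hB : ∀ s, 0 < s → DifferentiableAt ℝ B s)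
    (hA' : DifferentiableAt ℝ (deriv A) r) (hB' : DifferentiableAt ℝ (deriv B) r)
    (hκ : DifferentiableAt ℝ κ r) :
    ∑ I, ‖radCov κ (radCov κ (oneForm A B)) I r‖ ^ 2
      = (density2 (fun s => csch s * κ s + coth s) (fun s => A s + B s) r
        + density2 (fun s => csch s * κ s - coth s) (fun s => A s - B s) r) / 2 := by
  have hs : DifferentiableAt ℝ csch r := (hasDerivAt_csch hr).differentiableAt
  have hc : DifferentiableAt ℝ coth r := (hasDerivAt_coth hr).differentiableAt
  have hk : DifferentiableAt ℝ (fun s => ((csch s * κ s : ℝ) : ℂ)) r :=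
    Complex.ofRealCLM.differentiableAt.comp r (hs.mul hκ)
  have hcc : DifferentiableAt ℝ (fun s => (coth s : ℂ)) r :=
    Complex.ofRealCLM.differentiableAt.comp r hc
  set P := fun s => ((csch s * κ s : ℝ) : ℂ) * A s + coth s * B s with hP
  set Q := fun s => ((csch s * κ s : ℝ) : ℂ) * B s + coth s * A s with hQ
  have hPd : DifferentiableAt ℝ P r := (hk.mul (hA r hr)).add (hcc.mul (hB r hr))
  have hQd : DifferentiableAt ℝ Q r := (hk.mul (hB r hr)).add (hcc.mul (hA r hr))
  set Ψ := radCov κ (oneForm A B)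
  have p00 : Ψ ![0, 0] = deriv A := funext (radCov_oneForm_zero_zero κ A B)
  have p01 : Ψ ![0, 1] = fun s => -Complex.I * deriv B s :=
    funext (radCov_oneForm_zero_one κ A B)
  have p10 : Ψ ![1, 0] = fun s => Complex.I * P s := funext (radCov_oneForm_one_zero κ A B)
  have p11 : Ψ ![1, 1] = Q := funext (radCov_oneForm_one_one κ A B)
  have nI : ∀ z : ℂ, ‖Complex.I * z‖ = ‖z‖ := fun z => by
    rw [norm_mul, Complex.norm_I, one_mul]
  have d1 : deriv (deriv fun s => A s + B s) r = deriv (deriv A) r + deriv (deriv B) r := by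
    have : (deriv fun s => A s + B s) =ᶠ[𝓝 r] fun s => deriv A s + deriv B s := by
      filter_upwards [Ioi_mem_nhds hr] with s hs using deriv_fun_add (hA s hs) (hB s hs)
    rw [this.deriv_eq, deriv_fun_add hA' hB']
  have d2 : deriv (deriv fun s => A s - B s) r = deriv (deriv A) r - deriv (deriv B) r := by
    have : (deriv fun s => A s - B s) =ᶠ[𝓝 r] fun s => deriv A s - deriv B s := by
      filter_upwards [Ioi_mem_nhds hr] with s hs using deriv_fun_sub (hA s hs) (hB s hs)
    rw [this.deriv_eq, deriv_fun_sub hA' hB']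
  have d3 : deriv (fun s => ((csch s * κ s + coth s : ℝ) : ℂ) * (A s + B s)) r
      = deriv P r + deriv Q r := by
    rw [← deriv_fun_add hPd hQd]
    congr 1; funext s; simp only [hP, hQ]; push_cast; ring
  have d4 : deriv (fun s => ((csch s * κ s - coth s : ℝ) : ℂ) * (A s - B s)) r
      = deriv P r - deriv Q r := by
    rw [← deriv_fun_sub hPd hQd]
    congr 1; funext s; simp only [hP, hQ]; push_cast; ring
  have I2 := Complex.I_sq
  rw [sum_rank_three, parallelogram_I (radCov κ Ψ ![0, 0, 0] r),
    parallelogram_I (radCov κ Ψ ![0, 1, 0] r), parallelogram_I (radCov κ Ψ ![1, 0, 0] r),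
    parallelogram_I (radCov κ Ψ ![1, 1, 0] r)]
  simp only [radCov_cons_zero, radCov_one_tensor, p00, p01, p10, p11, conn_one_zero_zero,
    conn_one_zero_one, conn_one_one_zero, conn_one_one_one, density2, d1, d2, d3, d4,
    deriv_const_mul_field, deriv_fun_add (hA r hr) (hB r hr), deriv_fun_sub (hA r hr) (hB r hr)]
  have e1 : Complex.I * (-Complex.I * deriv (deriv B) r) = deriv (deriv B) r := by
    linear_combination (-deriv (deriv B) r) * I2
  rw [e1, ← mul_add, ← mul_sub, nI, nI]
  -- The components with direction indices `1, 0` are `i` times the expressions in `density2`, so a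
  -- harmless factor `i` is inserted there before matching.
  rw [← nI (((csch r * κ r + coth r : ℝ) : ℂ) * (deriv A r + deriv B r) - _),
    ← nI (((csch r * κ r - coth r : ℝ) : ℂ) * (deriv A r - deriv B r) - _)]
  have f1 : ∀ x y x' y' : ℂ, x + Complex.I * y = x' → x - Complex.I * y = y' →
      (‖x + Complex.I * y‖ ^ 2 + ‖x - Complex.I * y‖ ^ 2) / 2
        = (‖x'‖ ^ 2 + ‖y'‖ ^ 2) / 2 := by
    rintro x y _ _ rfl rfl; rfl
  rw [f1 _ _ (Complex.I * (((csch r * κ r + coth r : ℝ) : ℂ) * (deriv A r + deriv B r)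
      - coth r * (((csch r * κ r + coth r : ℝ) : ℂ) * (A r + B r))))
    (Complex.I * (((csch r * κ r - coth r : ℝ) : ℂ) * (deriv A r - deriv B r)
      - coth r * (((csch r * κ r - coth r : ℝ) : ℂ) * (A r - B r)))) ?_ ?_,
    f1 _ _ (coth r * (deriv A r + deriv B r)
      - ((csch r * κ r + coth r : ℝ) : ℂ) ^ 2 * (A r + B r))
    (coth r * (deriv A r - deriv B r)
      - ((csch r * κ r - coth r : ℝ) : ℂ) ^ 2 * (A r - B r)) ?_ ?_]
  · ring
  all_goals
    simp only [hP, hQ]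
    push_cast
    ring_nf
    simp only [I2, show Complex.I ^ 3 = -Complex.I by rw [pow_succ, I2]; ring]
    ring

end Components

/-! ### One-dimensional Sobolev estimate and pointwise comparison of densities -/

section Estimates

/-- Integrate `-(|f|²)' ≤ 2 |f| |f'|` from `r` to `R`. If the claim failed, `|f(R)|²` would stay
above a positive constant for all `R ≥ r`, against the integrability of `|f|² sinh`. The free factor
`k` allows both the weight `sinh r` and the weight `1`. -/
theorem mul_norm_sq_le_of_lintegral {f : ℝ → ℂ} (hf : ∀ s, 0 < s → HasDerivAt f (deriv f s) s)
    (hc : ContinuousOn (deriv f) (Ioi 0)) {Φ : ℝ → ℝ} {k C N r : ℝ} (hr : 0 < r) (hk : 0 < k)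
    (hN : 0 ≤ N) (hC : 0 ≤ C)
    (h1 : ∀ᵐ s ∂volume.restrict (Ioi r), k * (2 * ‖f s‖ * ‖deriv f s‖) ≤ Φ s)
    (h2 : ∀ᵐ s ∂volume.restrict (Ioi r), ‖f s‖ ^ 2 * Real.sinh s ≤ C * Φ s)
    (hΦ : ∫⁻ s in Ioi r, ENNReal.ofReal (Φ s) ≤ ENNReal.ofReal N) :
    k * ‖f r‖ ^ 2 ≤ N := by
  by_contra! hlt
  have hsub : ∀ R, r ≤ R → uIcc r R ⊆ Ioi 0 := fun R hR x hx => by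
    rw [uIcc_of_le hR] at hx
    exact hr.trans_le hx.1
  have hfc : ContinuousOn f (Ioi 0) := fun s hs => (hf s hs).continuousAt.continuousWithinAt
  have hbound : ∀ R, r ≤ R → k * (‖f r‖ ^ 2 - ‖f R‖ ^ 2) ≤ N := by
    intro R hR
    have hd : ∀ s ∈ uIcc r R, HasDerivAt (fun s => ‖f s‖ ^ 2) (2 * inner ℝ (f s) (deriv f s)) s :=
      fun s hs => (hf s (hsub R hR hs)).norm_sq
    have hci : ContinuousOn (fun s => 2 * inner ℝ (f s) (deriv f s)) (uIcc r R) :=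
      continuousOn_const.mul ((hfc.mono (hsub R hR)).inner (hc.mono (hsub R hR)))
    have hcg : ContinuousOn (fun s => k * (2 * ‖f s‖ * ‖deriv f s‖)) (uIcc r R) :=
      continuousOn_const.mul ((continuousOn_const.mul (hfc.mono (hsub R hR)).norm).mul
        (hc.mono (hsub R hR)).norm)
    have hint := intervalIntegral.integral_eq_sub_of_hasDerivAt hd hci.intervalIntegrable
    have hle : k * (‖f r‖ ^ 2 - ‖f R‖ ^ 2)
        ≤ ∫ s in r..R, k * (2 * ‖f s‖ * ‖deriv f s‖) := by
      have : k * (‖f r‖ ^ 2 - ‖f R‖ ^ 2)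
          = ∫ s in r..R, -k * (2 * inner ℝ (f s) (deriv f s)) := by
        rw [intervalIntegral.integral_const_mul, hint]; ring
      rw [this]
      refine intervalIntegral.integral_mono_on hR
        (hci.intervalIntegrable.const_mul (-k)) hcg.intervalIntegrable fun s _ => ?_
      have := neg_le_of_abs_le (abs_real_inner_le_norm (f s) (deriv f s))
      nlinarith
    refine hle.trans ?_
    rw [intervalIntegral.integral_of_le hR]
    have hI : IntegrableOn (fun s => k * (2 * ‖f s‖ * ‖deriv f s‖)) (Ioc r R) :=
      (intervalIntegrable_iff_integrableOn_Ioc_of_le hR).1 hcg.intervalIntegrable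
    rw [← ENNReal.ofReal_le_ofReal_iff hN, ofReal_integral_eq_lintegral_ofReal hI
      (Eventually.of_forall fun s => by positivity)]
    refine le_trans ?_ hΦ
    refine le_trans (lintegral_mono_set Ioc_subset_Ioi_self) ?_
    exact lintegral_mono_ae (h1.mono fun s hs => ENNReal.ofReal_le_ofReal hs)
  -- The constant that would bound `|f|²` from below on all of `[r, ∞)`.
  set δ := ‖f r‖ ^ 2 - N / k with hδ
  have hδ0 : 0 < δ := by
    rw [hδ, sub_pos, div_lt_iff₀ hk]; linarith
  have hlow : ∀ R, r ≤ R → δ ≤ ‖f R‖ ^ 2 := by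
    intro R hR
    have h := hbound R hR
    have : ‖f r‖ ^ 2 - ‖f R‖ ^ 2 ≤ N / k := by rw [le_div_iff₀ hk]; linarith
    linarith
  have hs0 : 0 < Real.sinh r := Real.sinh_pos_iff.2 hr
  have htop : ∫⁻ _ in Ioi r, ENNReal.ofReal (δ * Real.sinh r) = ⊤ := by
    rw [lintegral_const, Measure.restrict_apply MeasurableSet.univ, univ_inter, Real.volume_Ioi]
    exact ENNReal.mul_top (by simpa using mul_pos hδ0 hs0)
  have hfin : ∫⁻ _ in Ioi r, ENNReal.ofReal (δ * Real.sinh r)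
      ≤ ENNReal.ofReal C * ENNReal.ofReal N := by
    refine le_trans ?_ (mul_le_mul_right hΦ _)
    rw [← lintegral_const_mul' _ _ ENNReal.ofReal_ne_top]
    refine lintegral_mono_ae ?_
    filter_upwards [h2, ae_restrict_mem measurableSet_Ioi] with s hs hsr
    rw [← ENNReal.ofReal_mul hC]
    refine ENNReal.ofReal_le_ofReal (le_trans ?_ hs)
    have hsr : r < s := hsr
    exact mul_le_mul (hlow s hsr.le) (Real.sinh_le_sinh.2 hsr.le) hs0.le (by positivity)
  rw [htop] at hfin
  exact absurd hfin (not_le.2 (ENNReal.mul_lt_top ENNReal.ofReal_lt_top ENNReal.ofReal_lt_top))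

/-- The mean value inequality on `[ε, r]`, followed by `ε → 0`; this is where the value of the
height at the origin enters. -/
theorem sub_le_of_abs_deriv_le {κ κ' : ℝ → ℝ} (hκ : ∀ s, 0 < s → HasDerivAt κ (κ' s) s)
    (h1 : Tendsto κ (𝓝[>] 0) (𝓝 1)) {r D : ℝ} (hr : 0 < r)
    (hD : ∀ s, 0 < s → s ≤ r → |κ' s| ≤ D) : 1 - κ r ≤ D * r := by
  have hlim : Tendsto (fun ε => κ ε - κ r) (𝓝[>] 0) (𝓝 (1 - κ r)) := h1.sub_const _
  refine le_of_tendsto hlim ?_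
  filter_upwards [Ioo_mem_nhdsGT hr] with ε hε
  have hD0 : 0 ≤ D := (abs_nonneg _).trans (hD r hr le_rfl)
  have h := (convex_Icc ε r).norm_image_sub_le_of_norm_hasDerivWithin_le (f := κ) (f' := κ')
    (C := D) (fun s hs => (hκ s (hε.1.trans_le hs.1)).hasDerivWithinAt)
    (fun s hs => hD s (hε.1.trans_le hs.1) hs.2) (right_mem_Icc.2 hε.2.le) (left_mem_Icc.2 hε.2.le)
  rw [Real.norm_eq_abs, Real.norm_eq_abs, abs_of_neg (by linarith [hε.2] : ε - r < 0)] at h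
  nlinarith [le_abs_self (κ ε - κ r), hε.1]

/-- The total squared density, up to second order. -/
noncomputable def density (μ : ℝ → ℝ) (ψ : ℝ → ℂ) (r : ℝ) : ℝ :=
  ‖ψ r‖ ^ 2 + density1 μ ψ r + density2 μ ψ r

theorem density_nonneg (μ : ℝ → ℝ) (ψ : ℝ → ℂ) (r : ℝ) : 0 ≤ density μ ψ r := by
  unfold density density1 density2; positivity

theorem csch_pos {r : ℝ} (hr : 0 < r) : 0 < csch r := inv_pos.2 (Real.sinh_pos_iff.2 hr)

theorem csch_mul_sinh {r : ℝ} (hr : 0 < r) : csch r * Real.sinh r = 1 :=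
  inv_mul_cancel₀ (Real.sinh_pos_iff.2 hr).ne'

theorem coth_sq {r : ℝ} (hr : 0 < r) : coth r ^ 2 = csch r ^ 2 + 1 := by
  have hs := (Real.sinh_pos_iff.2 hr).ne'
  rw [coth, csch]; field_simp
  linarith [Real.cosh_sq_sub_sinh_sq r]

theorem csch_le_coth {r : ℝ} (hr : 0 < r) : csch r ≤ coth r := by
  have hs := Real.sinh_pos_iff.2 hr
  rw [coth, csch, inv_eq_one_div, div_le_div_iff_of_pos_right hs]
  exact Real.one_le_cosh r

theorem coth_sub_csch_le_one {r : ℝ} (hr : 0 < r) : coth r - csch r ≤ 1 := by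
  have h1 := coth_sq hr
  have h2 := csch_pos hr
  have h3 := csch_le_coth hr
  nlinarith

theorem csch_mul_sub_le_one {r : ℝ} (hr : 0 < r) : csch r * (coth r - csch r) ≤ 1 := by
  have h1 := coth_sq hr
  have h2 := csch_pos hr
  have h3 := csch_le_coth hr
  nlinarith

theorem norm_sq_add_le (x y : ℂ) : ‖x + y‖ ^ 2 ≤ 2 * (‖x‖ ^ 2 + ‖y‖ ^ 2) := by
  have := norm_add_le x y
  nlinarith [norm_nonneg (x + y), norm_nonneg x, norm_nonneg y, sq_nonneg (‖x‖ - ‖y‖)]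

theorem norm_sq_add_add_le (x y z : ℂ) :
    ‖x + y + z‖ ^ 2 ≤ 3 * (‖x‖ ^ 2 + ‖y‖ ^ 2 + ‖z‖ ^ 2) := by
  have h := (norm_add_le (x + y) z).trans (add_le_add_left (norm_add_le x y) _)
  have h2 := pow_le_pow_left₀ (norm_nonneg _) h 2
  nlinarith [sq_nonneg (‖x‖ - ‖y‖), sq_nonneg (‖x‖ - ‖z‖), sq_nonneg (‖y‖ - ‖z‖)]

theorem norm_sq_ofReal_mul_le {a L : ℝ} (h : |a| ≤ L) (z : ℂ) :
    ‖(a : ℂ) * z‖ ^ 2 ≤ L ^ 2 * ‖z‖ ^ 2 := by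
  rw [norm_mul, mul_pow, Complex.norm_real, Real.norm_eq_abs]
  gcongr

/-- Replacing `ν` by `μ` changes each term of the density by bounded multiples of `ψ` and `ψ'`. The
four bounds on `e = μ - ν` are exactly those needed: `e` for first order and mixed terms, `e'` for
the derivative of `μ ψ`, `coth · e` for the Christoffel term, and `e (μ + ν) = μ² - ν²` for the
second angular derivative. -/
theorem density_le_density {μ ν : ℝ → ℝ} {ψ : ℝ → ℂ} {r L ν' e' : ℝ}
    (hψ : DifferentiableAt ℝ ψ r) (hν : HasDerivAt ν ν' r)
    (he' : HasDerivAt (fun s => μ s - ν s) e' r) (h1 : |μ r - ν r| ≤ L)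
    (h2 : |coth r * (μ r - ν r)| ≤ L) (h3 : |e'| ≤ L) (h4 : |(μ r - ν r) * (μ r + ν r)| ≤ L) :
    density μ ψ r ≤ (3 + 10 * L ^ 2) * density ν ψ r := by
  have hνψ : HasDerivAt (fun s => (ν s : ℂ) * ψ s) (ν' * ψ r + ν r * deriv ψ r) r :=
    hν.ofReal_comp.mul hψ.hasDerivAt
  have heψ : HasDerivAt (fun s => ((μ s - ν s : ℝ) : ℂ) * ψ s)
      (e' * ψ r + (μ r - ν r : ℝ) * deriv ψ r) r :=
    he'.ofReal_comp.mul hψ.hasDerivAt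
  have d : deriv (fun s => (μ s : ℂ) * ψ s) r
      = deriv (fun s => (ν s : ℂ) * ψ s) r + e' * ψ r + (μ r - ν r : ℝ) * deriv ψ r := by
    have : (fun s => (μ s : ℂ) * ψ s)
        = fun s => (ν s : ℂ) * ψ s + ((μ s - ν s : ℝ) : ℂ) * ψ s := by
      funext s; push_cast; ring
    rw [this, (hνψ.fun_add heψ).deriv, hνψ.deriv]; ring
  have i1 : ‖(μ r : ℂ) * ψ r‖ ^ 2 ≤ 2 * (‖(ν r : ℂ) * ψ r‖ ^ 2 + L ^ 2 * ‖ψ r‖ ^ 2) := by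
    have : (μ r : ℂ) * ψ r = ν r * ψ r + (μ r - ν r : ℝ) * ψ r := by push_cast; ring
    rw [this]
    refine (norm_sq_add_le _ _).trans ?_
    gcongr
    exact norm_sq_ofReal_mul_le h1 _
  have i2 := norm_sq_add_add_le (deriv (fun s => (ν s : ℂ) * ψ s) r) (e' * ψ r)
    ((μ r - ν r : ℝ) * deriv ψ r)
  rw [← d] at i2
  have j1 := norm_sq_ofReal_mul_le h3 (ψ r)
  have j2 := norm_sq_ofReal_mul_le h1 (deriv ψ r)
  have j3 := norm_sq_ofReal_mul_le h2 (ψ r)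
  have j4 := norm_sq_ofReal_mul_le h4 (ψ r)
  have i3 : ‖(μ r : ℂ) * deriv ψ r - coth r * (μ r * ψ r)‖ ^ 2
      ≤ 3 * (‖(ν r : ℂ) * deriv ψ r - coth r * (ν r * ψ r)‖ ^ 2 + L ^ 2 * ‖deriv ψ r‖ ^ 2
        + L ^ 2 * ‖ψ r‖ ^ 2) := by
    have : (μ r : ℂ) * deriv ψ r - coth r * (μ r * ψ r)
        = ((ν r : ℂ) * deriv ψ r - coth r * (ν r * ψ r)) + (μ r - ν r : ℝ) * deriv ψ r
          + -((coth r * (μ r - ν r) : ℝ) * ψ r) := by push_cast; ring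
    rw [this]
    refine (norm_sq_add_add_le _ _ _).trans ?_
    rw [norm_neg]
    gcongr
  have i4 : ‖coth r * deriv ψ r - (μ r : ℂ) ^ 2 * ψ r‖ ^ 2
      ≤ 2 * (‖coth r * deriv ψ r - (ν r : ℂ) ^ 2 * ψ r‖ ^ 2 + L ^ 2 * ‖ψ r‖ ^ 2) := by
    have : coth r * deriv ψ r - (μ r : ℂ) ^ 2 * ψ r
        = (coth r * deriv ψ r - (ν r : ℂ) ^ 2 * ψ r)
          + -(((μ r - ν r) * (μ r + ν r) : ℝ) * ψ r) := by push_cast; ring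
    rw [this]
    refine (norm_sq_add_le _ _).trans ?_
    rw [norm_neg]
    gcongr
  unfold density density1 density2
  set a0 := ‖ψ r‖ ^ 2
  set a1 := ‖deriv ψ r‖ ^ 2
  set a2 := ‖(ν r : ℂ) * ψ r‖ ^ 2
  set a3 := ‖deriv (deriv ψ) r‖ ^ 2
  set a4 := ‖deriv (fun s => (ν s : ℂ) * ψ s) r‖ ^ 2
  set a5 := ‖(ν r : ℂ) * deriv ψ r - coth r * (ν r * ψ r)‖ ^ 2
  set a6 := ‖coth r * deriv ψ r - (ν r : ℂ) ^ 2 * ψ r‖ ^ 2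
  have p0 : 0 ≤ a0 := by positivity
  have p1 : 0 ≤ a1 := by positivity
  have p2 : 0 ≤ a2 := by positivity
  have p3 : 0 ≤ a3 := by positivity
  have p4 : 0 ≤ a4 := by positivity
  have p5 : 0 ≤ a5 := by positivity
  have p6 : 0 ≤ a6 := by positivity
  have q1 : 0 ≤ L ^ 2 * a1 := by positivity
  have q2 : 0 ≤ L ^ 2 * a2 := by positivity
  have q3 : 0 ≤ L ^ 2 * a3 := by positivity
  have q4 : 0 ≤ L ^ 2 * a4 := by positivity
  have q5 : 0 ≤ L ^ 2 * a5 := by positivity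
  have q6 : 0 ≤ L ^ 2 * a6 := by positivity
  linarith

/-- The fields `ψ⁺`, `ψ⁻` together with the height of the map: the height tends to one at the
origin, and its derivative is controlled by the fields. -/
structure FieldTriple (f g : ℝ → ℂ) (κ κ' : ℝ → ℝ) : Prop where
  hasDerivAt_left : ∀ s, 0 < s → HasDerivAt f (deriv f s) s
  continuousOn_left : ContinuousOn (deriv f) (Ioi 0)
  hasDerivAt_right : ∀ s, 0 < s → HasDerivAt g (deriv g s) s
  continuousOn_right : ContinuousOn (deriv g) (Ioi 0)
  hasDerivAt_height : ∀ s, 0 < s → HasDerivAt κ (κ' s) s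
  tendsto_height : Tendsto κ (𝓝[>] 0) (𝓝 1)
  height_le_one : ∀ s, 0 < s → κ s ≤ 1
  abs_deriv_height_le : ∀ s, 0 < s → |κ' s| ≤ Real.sinh s * (‖f s‖ ^ 2 + ‖g s‖ ^ 2) / 4

/-- The integral over the hyperbolic plane of the densities of a pair of fields, up to the
constant `2 π`. -/
noncomputable def fieldEnergy (μ₁ μ₂ : ℝ → ℝ) (f g : ℝ → ℂ) : ℝ≥0∞ :=
  ∫⁻ r in Ioi (0 : ℝ), ENNReal.ofReal ((density μ₁ f r + density μ₂ g r) * Real.sinh r)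

end Estimates

/-! ### Bounds on the fields and the height, and comparison of the energies -/

section FieldEstimates

theorem mul_norm_sq_le_of_fieldEnergy {μ₁ μ₂ : ℝ → ℝ} {f g φ : ℝ → ℂ} {k M N r : ℝ}
    (hφ : ∀ s, 0 < s → HasDerivAt φ (deriv φ s) s) (hc : ContinuousOn (deriv φ) (Ioi 0))
    (hN : 0 ≤ N) (hE : fieldEnergy μ₁ μ₂ f g ≤ .ofReal N) (hr : 0 < r) (hk : 0 < k) (hM : 0 < M)
    (h0 : ∀ s, 0 < s → ‖φ s‖ ^ 2 ≤ density μ₁ f s + density μ₂ g s)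
    (h : ∀ s, r < s → k * (2 * ‖φ s‖ * ‖deriv φ s‖)
      ≤ M * ((density μ₁ f s + density μ₂ g s) * Real.sinh s)) :
    k * ‖φ r‖ ^ 2 ≤ M * N := by
  -- The inverse cancels the factor `M` in `Φ`, since `|φ|² sinh` is bounded by the density without
  -- it.
  refine mul_norm_sq_le_of_lintegral hφ hc (C := M⁻¹)
    (Φ := fun s => M * ((density μ₁ f s + density μ₂ g s) * Real.sinh s)) hr hk
    (by positivity) (by positivity) ?_ ?_ ?_
  · filter_upwards [ae_restrict_mem measurableSet_Ioi] with s hs using h s hs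
  · filter_upwards [ae_restrict_mem measurableSet_Ioi] with s hs
    have hs : 0 < s := hr.trans hs
    rw [inv_mul_cancel_left₀ hM.ne']
    exact mul_le_mul_of_nonneg_right (h0 s hs) (Real.sinh_pos_iff.2 hs).le
  · simp only [ENNReal.ofReal_mul hM.le]
    rw [lintegral_const_mul' _ _ ENNReal.ofReal_ne_top]
    gcongr
    exact (lintegral_mono_set (Ioi_subset_Ioi hr.le)).trans hE

theorem norm_sq_add_norm_deriv_sq_le_density (μ : ℝ → ℝ) (ψ : ℝ → ℂ) (r : ℝ) :
    ‖ψ r‖ ^ 2 + ‖deriv ψ r‖ ^ 2 + ‖(μ r : ℂ) * ψ r‖ ^ 2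
      + ‖coth r * deriv ψ r - (μ r : ℂ) ^ 2 * ψ r‖ ^ 2 ≤ density μ ψ r := by
  unfold density density1 density2
  have : 0 ≤ ‖deriv (deriv ψ) r‖ ^ 2 + ‖deriv (fun s => (μ s : ℂ) * ψ s) r‖ ^ 2
    + ‖(μ r : ℂ) * deriv ψ r - coth r * (μ r * ψ r)‖ ^ 2 := by positivity
  linarith

/-- A Strauss-type radial bound: on `(r, ∞)` the weight `sinh r` is at most `sinh s`, so `2 |φ|
|φ'|` is absorbed by the density. It holds for any multipliers, hence can start the argument from
either norm. -/
theorem sinh_mul_norm_sq_le {μ₁ μ₂ : ℝ → ℝ} {f g φ : ℝ → ℂ} {N r : ℝ}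
    (hφ : ∀ s, 0 < s → HasDerivAt φ (deriv φ s) s) (hc : ContinuousOn (deriv φ) (Ioi 0))
    (hN : 0 ≤ N) (hE : fieldEnergy μ₁ μ₂ f g ≤ .ofReal N) (hr : 0 < r)
    (h : ∀ s, ‖φ s‖ ^ 2 + ‖deriv φ s‖ ^ 2 ≤ density μ₁ f s + density μ₂ g s) :
    Real.sinh r * ‖φ r‖ ^ 2 ≤ N := by
  have hs := Real.sinh_pos_iff.2 hr
  rw [← one_mul N]
  refine mul_norm_sq_le_of_fieldEnergy hφ hc hN hE hr hs one_pos
    (fun s _ => le_trans (le_add_of_nonneg_right (by positivity)) (h s)) fun s hrs => ?_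
  have h1 := Real.sinh_le_sinh.2 hrs.le
  have h2 := h s
  have h3 : 2 * ‖φ s‖ * ‖deriv φ s‖ ≤ ‖φ s‖ ^ 2 + ‖deriv φ s‖ ^ 2 := two_mul_le_add_sq _ _
  rw [one_mul, mul_comm]
  exact mul_le_mul (h3.trans h2) h1 hs.le (by positivity [density_nonneg μ₁ f s, density_nonneg μ₂ g s])

namespace FieldTriple

variable {f g : ℝ → ℂ} {κ κ' : ℝ → ℝ} {μ₁ μ₂ : ℝ → ℝ} {N r : ℝ}

/-- The weighted bounds on both fields give `|κ'| ≤ N / 2`; integrating from the origin and using `r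
≤ sinh r` finishes. This first, weak estimate controls the multipliers. -/
theorem csch_mul_one_sub_height_le (T : FieldTriple f g κ κ') (hN : 0 ≤ N)
    (hE : fieldEnergy μ₁ μ₂ f g ≤ .ofReal N) (hr : 0 < r) :
    csch r * (1 - κ r) ≤ N := by
  have hd1 := norm_sq_add_norm_deriv_sq_le_density μ₁ f
  have hd2 := norm_sq_add_norm_deriv_sq_le_density μ₂ g
  have h : ∀ s, 0 < s → s ≤ r → |κ' s| ≤ N / 2 := by
    intro s hs _
    have b1 := sinh_mul_norm_sq_le T.hasDerivAt_left T.continuousOn_left hN hE hs fun s => by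
      have e1 : 0 ≤ ‖(μ₁ s : ℂ) * f s‖ ^ 2 := by positivity
      have e2 : 0 ≤ ‖coth s * deriv f s - (μ₁ s : ℂ) ^ 2 * f s‖ ^ 2 := by positivity
      linarith [hd1 s, density_nonneg μ₂ g s]
    have b2 := sinh_mul_norm_sq_le T.hasDerivAt_right T.continuousOn_right hN hE hs fun s => by
      have e1 : 0 ≤ ‖(μ₂ s : ℂ) * g s‖ ^ 2 := by positivity
      have e2 : 0 ≤ ‖coth s * deriv g s - (μ₂ s : ℂ) ^ 2 * g s‖ ^ 2 := by positivity
      linarith [hd2 s, density_nonneg μ₁ f s]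
    refine (T.abs_deriv_height_le s hs).trans ?_
    linarith
  have h1 := sub_le_of_abs_deriv_le T.hasDerivAt_height T.tendsto_height hr h
  have h2 : r ≤ Real.sinh r := Real.self_le_sinh_iff.2 hr.le
  have h3 := csch_mul_sinh hr
  have h4 := csch_pos hr
  have h5 : csch r * (1 - κ r) ≤ csch r * (N / 2 * Real.sinh r) := by
    refine mul_le_mul_of_nonneg_left (h1.trans ?_) h4.le
    gcongr
  have h6 : csch r * (N / 2 * Real.sinh r) = N / 2 := by linear_combination N / 2 * h3
  linarith

/-- As the multiplier is within `E` of `2 csch`, the density controls `|csch · f|²`. Hence `2 |f|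
|f'| = 2 |csch · f| |f'| sinh` is integrable up to the origin, and the bound needs no weight. -/
theorem norm_left_sq_le (T : FieldTriple f g κ κ') (hN : 0 ≤ N)
    (hE : fieldEnergy μ₁ μ₂ f g ≤ .ofReal N) (hr : 0 < r) {E : ℝ}
    (hμ₁ : ∀ s, 0 < s → |csch s * 2 - μ₁ s| ≤ E) :
    ‖f r‖ ^ 2 ≤ (2 + 2 * E ^ 4) * N := by
  rw [← one_mul (‖f r‖ ^ 2)]
  have hd1 := norm_sq_add_norm_deriv_sq_le_density μ₁ f
  refine mul_norm_sq_le_of_fieldEnergy T.hasDerivAt_left T.continuousOn_left hN hE hr one_pos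
    (by positivity) (fun s hs => ?_) fun s hrs => ?_
  · have e0 : 0 ≤ ‖deriv f s‖ ^ 2 + ‖(μ₁ s : ℂ) * f s‖ ^ 2
      + ‖coth s * deriv f s - (μ₁ s : ℂ) ^ 2 * f s‖ ^ 2 := by positivity
    linarith [hd1 s, density_nonneg μ₂ g s]
  have hs : 0 < s := hr.trans hrs
  have hsh := Real.sinh_pos_iff.2 hs
  have k1 : ‖((csch s * 2 : ℝ) : ℂ) * f s‖ ^ 2
      ≤ 2 * (‖(μ₁ s : ℂ) * f s‖ ^ 2 + E ^ 2 * ‖f s‖ ^ 2) := by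
    have : ((csch s * 2 : ℝ) : ℂ) * f s = μ₁ s * f s + (csch s * 2 - μ₁ s : ℝ) * f s := by
      push_cast; ring
    rw [this]
    refine (norm_sq_add_le _ _).trans ?_
    gcongr
    exact norm_sq_ofReal_mul_le (hμ₁ s hs) _
  rw [norm_mul, Complex.norm_real, Real.norm_of_nonneg (by linarith [csch_pos hs])] at k1
  have k2 : 2 * (csch s * ‖f s‖) * ‖deriv f s‖ ≤ (csch s * ‖f s‖) ^ 2 + ‖deriv f s‖ ^ 2 :=
    two_mul_le_add_sq _ _
  have k3 : 0 ≤ ‖coth s * deriv f s - (μ₁ s : ℂ) ^ 2 * f s‖ ^ 2 := by positivity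
  have k4 : E ^ 2 ≤ 1 + E ^ 4 := by nlinarith [sq_nonneg (E ^ 2 - 1)]
  have k5 := hd1 s
  have k6 := density_nonneg μ₂ g s
  have k7 : E ^ 2 * ‖f s‖ ^ 2 ≤ (1 + E ^ 4) * ‖f s‖ ^ 2 := by gcongr
  have k8 : 2 * (csch s * ‖f s‖) * ‖deriv f s‖
      ≤ (2 + 2 * E ^ 4) * (density μ₁ f s + density μ₂ g s) := by
    have k9 : (2 + 2 * E ^ 4) * (‖f s‖ ^ 2 + ‖deriv f s‖ ^ 2 + ‖(μ₁ s : ℂ) * f s‖ ^ 2)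
        ≤ (2 + 2 * E ^ 4) * (density μ₁ f s + density μ₂ g s) := by
      exact mul_le_mul_of_nonneg_left (by linarith) (by positivity)
    have k10 : 0 ≤ E ^ 4 * ‖f s‖ ^ 2 := by positivity
    have k11 : 0 ≤ E ^ 4 * ‖deriv f s‖ ^ 2 := by positivity
    have k12 : 0 ≤ E ^ 4 * ‖(μ₁ s : ℂ) * f s‖ ^ 2 := by positivity
    have k13 : 0 ≤ ‖f s‖ ^ 2 := by positivity
    have k14 : 0 ≤ ‖deriv f s‖ ^ 2 := by positivity
    have k15 : 0 ≤ ‖(μ₁ s : ℂ) * f s‖ ^ 2 := by positivity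
    nlinarith
  have k16 := mul_le_mul_of_nonneg_right k8 hsh.le
  have k17 : 1 * (2 * ‖f s‖ * ‖deriv f s‖)
      = 2 * (csch s * ‖f s‖) * ‖deriv f s‖ * Real.sinh s := by
    linear_combination -(2 * ‖f s‖ * ‖deriv f s‖) * csch_mul_sinh hs
  rw [k17]; linarith

/-- Here the multiplier is bounded and gives no decay of `g` at the origin. The factor `csch` falls
on the derivative instead: `coth · g' - μ₂² g` is part of the second order density, and `csch ≤
coth`. -/
theorem norm_right_sq_le (T : FieldTriple f g κ κ') (hN : 0 ≤ N)
    (hE : fieldEnergy μ₁ μ₂ f g ≤ .ofReal N) (hr : 0 < r) {E : ℝ}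
    (hμ₂ : ∀ s, 0 < s → |μ₂ s| ≤ E) :
    ‖g r‖ ^ 2 ≤ (2 + 2 * E ^ 4) * N := by
  rw [← one_mul (‖g r‖ ^ 2)]
  have hd1 := norm_sq_add_norm_deriv_sq_le_density μ₂ g
  refine mul_norm_sq_le_of_fieldEnergy T.hasDerivAt_right T.continuousOn_right hN hE hr one_pos
    (by positivity) (fun s hs => ?_) fun s hrs => ?_
  · have e0 : 0 ≤ ‖deriv g s‖ ^ 2 + ‖(μ₂ s : ℂ) * g s‖ ^ 2
      + ‖coth s * deriv g s - (μ₂ s : ℂ) ^ 2 * g s‖ ^ 2 := by positivity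
    linarith [hd1 s, density_nonneg μ₁ f s]
  have hs : 0 < s := hr.trans hrs
  have hsh := Real.sinh_pos_iff.2 hs
  have k0 : |μ₂ s ^ 2| ≤ E ^ 2 := by
    rw [abs_pow]
    exact pow_le_pow_left₀ (abs_nonneg _) (hμ₂ s hs) 2
  have k1 : ‖(coth s : ℂ) * deriv g s‖ ^ 2
      ≤ 2 * (‖coth s * deriv g s - (μ₂ s : ℂ) ^ 2 * g s‖ ^ 2 + (E ^ 2) ^ 2 * ‖g s‖ ^ 2) := by
    have : (coth s : ℂ) * deriv g s
        = (coth s * deriv g s - (μ₂ s : ℂ) ^ 2 * g s) + (μ₂ s ^ 2 : ℝ) * g s := by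
      push_cast; ring
    have k := norm_sq_add_le (coth s * deriv g s - (μ₂ s : ℂ) ^ 2 * g s) ((μ₂ s ^ 2 : ℝ) * g s)
    rw [← this] at k
    linarith [norm_sq_ofReal_mul_le k0 (g s)]
  have hcs := csch_pos hs
  have hcc := csch_le_coth hs
  rw [norm_mul, Complex.norm_real, Real.norm_of_nonneg (by linarith)] at k1
  have k2 : 2 * ‖g s‖ * (csch s * ‖deriv g s‖) ≤ ‖g s‖ ^ 2 + (coth s * ‖deriv g s‖) ^ 2 := by
    refine (two_mul_le_add_sq _ _).trans ?_
    gcongr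
  have k5 := hd1 s
  have k6 := density_nonneg μ₁ f s
  have k8 : 2 * ‖g s‖ * (csch s * ‖deriv g s‖)
      ≤ (2 + 2 * E ^ 4) * (density μ₁ f s + density μ₂ g s) := by
    set X := ‖coth s * deriv g s - (μ₂ s : ℂ) ^ 2 * g s‖ ^ 2
    have k9 : (2 + 2 * E ^ 4) * (‖g s‖ ^ 2 + X)
        ≤ (2 + 2 * E ^ 4) * (density μ₁ f s + density μ₂ g s) := by
      have : 0 ≤ ‖deriv g s‖ ^ 2 + ‖(μ₂ s : ℂ) * g s‖ ^ 2 := by positivity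
      exact mul_le_mul_of_nonneg_left (by linarith) (by positivity)
    have k12 : 0 ≤ E ^ 4 * X := by positivity
    have k13 : 0 ≤ ‖g s‖ ^ 2 := by positivity
    have k14 : 0 ≤ X := by positivity
    nlinarith
  have k16 := mul_le_mul_of_nonneg_right k8 hsh.le
  have k17 : 1 * (2 * ‖g s‖ * ‖deriv g s‖)
      = 2 * ‖g s‖ * (csch s * ‖deriv g s‖) * Real.sinh s := by
    linear_combination -(2 * ‖g s‖ * ‖deriv g s‖) * csch_mul_sinh hs
  rw [k17]; linarith

/-- The bound for the geometric quantities in terms of the energy of the fields. -/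
noncomputable def heightBound (N : ℝ) : ℝ := N * (1 + (1 + N) ^ 4)

/-- Second pass: the uniform bounds on the fields, with `E = 1 + N`, improve the estimate to `|κ'| ≤
K sinh` with `K = heightBound N`. Integration then gives `1 - κ ≤ K r sinh r ≤ K sinh² r`. -/
theorem height_bounds (T : FieldTriple f g κ κ') (hN : 0 ≤ N)
    (hE : fieldEnergy μ₁ μ₂ f g ≤ .ofReal N)
    (hμ₁ : ∀ s, 0 < s → |csch s * 2 - μ₁ s| ≤ 1 + N) (hμ₂ : ∀ s, 0 < s → |μ₂ s| ≤ 1 + N)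
    (hr : 0 < r) :
    csch r * (1 - κ r) ≤ heightBound N ∧ csch r * (csch r * (1 - κ r)) ≤ heightBound N ∧
      csch r * |κ' r| ≤ heightBound N := by
  have h0 : ∀ s, 0 < s → |κ' s| ≤ Real.sinh s * heightBound N := by
    intro s hs
    have b1 := T.norm_left_sq_le hN hE hs hμ₁
    have b2 := T.norm_right_sq_le hN hE hs hμ₂
    refine (T.abs_deriv_height_le s hs).trans ?_
    rw [mul_div_assoc]
    refine mul_le_mul_of_nonneg_left ?_ (Real.sinh_pos_iff.2 hs).le
    unfold heightBound; linarith
  have hc := csch_pos hr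
  have hcs := csch_mul_sinh hr
  have hK : 0 ≤ heightBound N := by unfold heightBound; positivity
  have hs := Real.sinh_pos_iff.2 hr
  refine ⟨?_, ?_, ?_⟩
  · refine (T.csch_mul_one_sub_height_le hN hE hr).trans ?_
    unfold heightBound
    have : 0 ≤ N * (1 + N) ^ 4 := by positivity
    linarith
  · have h1 := sub_le_of_abs_deriv_le T.hasDerivAt_height T.tendsto_height hr fun s hs0 hsr =>
      (h0 s hs0).trans (mul_le_mul_of_nonneg_right (Real.sinh_le_sinh.2 hsr) hK)
    have h2 : r ≤ Real.sinh r := Real.self_le_sinh_iff.2 hr.le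
    calc csch r * (csch r * (1 - κ r))
        ≤ csch r * (csch r * (Real.sinh r * heightBound N * Real.sinh r)) := by
          gcongr
          exact h1.trans (by gcongr)
      _ = heightBound N := by
          linear_combination heightBound N * (csch r * Real.sinh r + 1) * hcs
  · calc csch r * |κ' r| ≤ csch r * (Real.sinh r * heightBound N) := by
          gcongr
          exact h0 r hr
      _ = heightBound N := by linear_combination heightBound N * hcs

end FieldTriple

/-- The constant in the comparison of densities. -/
noncomputable def densityConst (N : ℝ) : ℝ :=
  3 + 10 * ((FieldTriple.heightBound N + 3) ^ 2) ^ 2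

theorem densityConst_nonneg (N : ℝ) : 0 ≤ densityConst N := by unfold densityConst; positivity

theorem abs_multiplier_sub_le {κ r K σ : ℝ} (hσ : |σ| = 1) (hr : 0 < r) (hκ : κ ≤ 1)
    (h1 : csch r * (1 - κ) ≤ K) :
    |csch r * κ + σ * coth r - csch r * (1 + σ)| ≤ 1 + K := by
  have hc := csch_pos hr
  have ht := csch_le_coth hr
  have ht1 := coth_sub_csch_le_one hr
  have e : csch r * κ + σ * coth r - csch r * (1 + σ)
      = -(csch r * (1 - κ)) + σ * (coth r - csch r) := by ring
  rw [e]
  refine (abs_add_le _ _).trans ?_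
  rw [abs_neg, abs_of_nonneg (mul_nonneg hc.le (by linarith)), abs_mul, hσ,
    abs_of_nonneg (by linarith : 0 ≤ coth r - csch r)]
  linarith

/-- The sign `σ` treats `ψ⁺` and `ψ⁻` together, the target multiplier `csch · (1 + σ)` being `2
csch` or `0`. All bounds follow from `μ - ν = -csch (1 - κ) + σ (coth - csch)`, as `coth - csch` and
`csch (coth - csch)` are at most one. The constant `(K + 3)²` dominates all four. -/
theorem multiplier_estimates {κ κ' : ℝ → ℝ} {r K σ : ℝ} (hσ : σ = 1 ∨ σ = -1) (hr : 0 < r) (hκ : HasDerivAt κ (κ' r) r) (hκ1 : κ r ≤ 1)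
    (h1 : csch r * (1 - κ r) ≤ K) (h2 : csch r * (csch r * (1 - κ r)) ≤ K)
    (h3 : csch r * |κ' r| ≤ K) :
    let μ := fun s => csch s * κ s + σ * coth s
    let ν := fun s => csch s * (1 + σ)
    let L := (K + 3) ^ 2
    (∃ e', HasDerivAt (fun s => μ s - ν s) e' r ∧ |e'| ≤ L) ∧
      |μ r - ν r| ≤ L ∧ |coth r * (μ r - ν r)| ≤ L ∧ |(μ r - ν r) * (μ r + ν r)| ≤ L := by
  intro μ ν L
  have hc := csch_pos hr
  have ht := csch_le_coth hr
  have ht1 := coth_sub_csch_le_one hr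
  have ht2 := csch_mul_sub_le_one hr
  have hsq := coth_sq hr
  set h := csch r
  set c := coth r
  set q := h * (1 - κ r) with hq
  have hq0 : 0 ≤ q := mul_nonneg hc.le (by linarith)
  have hK : 0 ≤ K := hq0.trans h1
  have e1 : μ r - ν r = -q + σ * (c - h) := by
    simp only [μ, ν, hq]; ring
  have sabs : |σ| = 1 := by rcases hσ with h | h <;> simp [h]
  have b1 : |μ r - ν r| ≤ 1 + K := abs_multiplier_sub_le sabs hr hκ1 h1
  have b2 : |c * (μ r - ν r)| ≤ 2 * K + 2 := by
    have : c * (μ r - ν r) = -(h * q + (c - h) * q) + σ * (h * (c - h) + (c - h) * (c - h)) := by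
      rw [e1]; ring
    rw [this]
    refine (abs_add_le _ _).trans ?_
    have p1 : 0 ≤ h * q := mul_nonneg hc.le hq0
    have p2 : 0 ≤ (c - h) * q := mul_nonneg (by linarith) hq0
    have p3 : 0 ≤ h * (c - h) := mul_nonneg hc.le (by linarith)
    have p4 : 0 ≤ (c - h) * (c - h) := mul_self_nonneg _
    rw [abs_neg, abs_of_nonneg (by linarith), abs_mul, sabs, abs_of_nonneg (by linarith)]
    nlinarith
  have b3 : |h * (μ r - ν r)| ≤ K + 1 := by
    have : h * (μ r - ν r) = -(h * q) + σ * (h * (c - h)) := by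
      rw [e1]; ring
    rw [this]
    refine (abs_add_le _ _).trans ?_
    have p1 : 0 ≤ h * q := mul_nonneg hc.le hq0
    have p3 : 0 ≤ h * (c - h) := mul_nonneg hc.le (by linarith)
    rw [abs_neg, abs_of_nonneg p1, abs_mul, sabs, abs_of_nonneg p3]
    linarith
  have m0 : |2 * (1 + σ)| ≤ 4 := by rcases hσ with h | h <;> rw [h] <;> norm_num
  -- The derivative of `μ - ν`, rewritten by `coth² - csch² = 1` so that its singular parts are
  -- absorbed in quantities already bounded.
  refine ⟨⟨h * κ' r + σ - c * (μ r - ν r), ?_, ?_⟩, ?_, ?_, ?_⟩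
  · refine ((((hasDerivAt_csch hr).mul hκ).add ((hasDerivAt_coth hr).const_mul σ)).sub
      ((hasDerivAt_csch hr).mul_const (1 + σ))).congr_deriv ?_
    simp only [μ, ν]
    linear_combination σ * hsq
  · refine (abs_sub _ _).trans ?_
    have p5 := abs_add_le (h * κ' r) σ
    rw [abs_mul, abs_of_pos hc, sabs] at p5
    simp only [L]; nlinarith
  · simp only [L]; nlinarith
  · simp only [L]; nlinarith
  · have : (μ r - ν r) * (μ r + ν r) = 2 * (1 + σ) * (h * (μ r - ν r)) + (μ r - ν r) ^ 2 := by
      simp only [ν]; ring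
    rw [this]
    refine (abs_add_le _ _).trans ?_
    rw [abs_mul, abs_pow]
    have p6 : |2 * (1 + σ)| * |h * (μ r - ν r)| ≤ 4 * (K + 1) := by gcongr
    have p7 : |μ r - ν r| ^ 2 ≤ (1 + K) ^ 2 := by gcongr
    simp only [L]; nlinarith

namespace FieldTriple

variable {f g : ℝ → ℂ} {κ κ' : ℝ → ℝ} {N : ℝ}

/-- Both alternatives yield the same height bounds: the multipliers `2 csch` and `0` satisfy the
hypotheses of `height_bounds` trivially, those of the map by the weak estimate. The comparison of
densities is then symmetric in the two pairs. -/
theorem fieldEnergy_comparable (T : FieldTriple f g κ κ') (hN : 0 ≤ N)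
    (hE : fieldEnergy (fun s => csch s * κ s + coth s) (fun s => csch s * κ s - coth s) f g
        ≤ .ofReal N ∨
      fieldEnergy (fun s => csch s * 2) (fun s => csch s * 0) f g ≤ .ofReal N) :
    fieldEnergy (fun s => csch s * κ s + coth s) (fun s => csch s * κ s - coth s) f g
        ≤ .ofReal (densityConst N)
          * fieldEnergy (fun s => csch s * 2) (fun s => csch s * 0) f g ∧
      fieldEnergy (fun s => csch s * 2) (fun s => csch s * 0) f g
        ≤ .ofReal (densityConst N)
          * fieldEnergy (fun s => csch s * κ s + coth s) (fun s => csch s * κ s - coth s) f g := by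
  have hb : ∀ r, 0 < r → csch r * (1 - κ r) ≤ heightBound N ∧
      csch r * (csch r * (1 - κ r)) ≤ heightBound N ∧ csch r * |κ' r| ≤ heightBound N := by
    intro r hr
    rcases hE with hE | hE
    · refine T.height_bounds hN hE (fun s hs => ?_) (fun s hs => ?_) hr
      · have h := abs_multiplier_sub_le (σ := 1) abs_one hs (T.height_le_one s hs)
          (T.csch_mul_one_sub_height_le hN hE hs)
        rw [abs_sub_comm, one_mul] at h
        convert h using 3; norm_num
      · have h := abs_multiplier_sub_le (σ := -1) (by simp) hs (T.height_le_one s hs)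
          (T.csch_mul_one_sub_height_le hN hE hs)
        convert h using 2; ring
    · refine T.height_bounds hN hE (fun s _ => ?_) (fun s _ => ?_) hr
      · rw [sub_self, abs_zero]; linarith
      · rw [mul_zero, abs_zero]; linarith
  have e1 : ∀ r, 0 < r →
      density (fun s => csch s * κ s + coth s) f r
        ≤ densityConst N * density (fun s => csch s * 2) f r ∧
      density (fun s => csch s * 2) f r
        ≤ densityConst N * density (fun s => csch s * κ s + coth s) f r := by
    intro r hr
    obtain ⟨b1, b2, b3⟩ := hb r hr
    have h := multiplier_estimates (σ := 1) (Or.inl rfl) hr (T.hasDerivAt_height r hr)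
      (T.height_le_one r hr) b1 b2 b3
    simp only [one_mul, one_add_one_eq_two] at h
    obtain ⟨⟨e', he', h0⟩, h1, h2, h3⟩ := h
    have hf := (T.hasDerivAt_left r hr).differentiableAt
    have hν : HasDerivAt (fun s => csch s * 2) _ r := (hasDerivAt_csch hr).mul_const 2
    have hμ : HasDerivAt (fun s => csch s * κ s + coth s) _ r :=
      ((hasDerivAt_csch hr).mul (T.hasDerivAt_height r hr)).add (hasDerivAt_coth hr)
    refine ⟨density_le_density hf hν he' h1 h2 h0 h3, density_le_density hf hμ
      (he'.neg.congr_of_eventuallyEq (.of_forall fun s => ?_)) ?_ ?_ ?_ ?_⟩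
    · simp
    · rwa [abs_sub_comm]
    · rwa [abs_mul, abs_sub_comm, ← abs_mul]
    · rwa [abs_neg]
    · rwa [abs_mul, abs_sub_comm, add_comm (csch r * 2), ← abs_mul]
  have e2 : ∀ r, 0 < r →
      density (fun s => csch s * κ s - coth s) g r
        ≤ densityConst N * density (fun s => csch s * 0) g r ∧
      density (fun s => csch s * 0) g r
        ≤ densityConst N * density (fun s => csch s * κ s - coth s) g r := by
    intro r hr
    obtain ⟨b1, b2, b3⟩ := hb r hr
    have h := multiplier_estimates (σ := -1) (Or.inr rfl) hr (T.hasDerivAt_height r hr)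
      (T.height_le_one r hr) b1 b2 b3
    simp only [neg_one_mul, add_neg_cancel, ← sub_eq_add_neg] at h
    obtain ⟨⟨e', he', h0⟩, h1, h2, h3⟩ := h
    have hg := (T.hasDerivAt_right r hr).differentiableAt
    have hν : HasDerivAt (fun s => csch s * 0) _ r := (hasDerivAt_csch hr).mul_const 0
    have hμ : HasDerivAt (fun s => csch s * κ s - coth s) _ r :=
      ((hasDerivAt_csch hr).mul (T.hasDerivAt_height r hr)).sub (hasDerivAt_coth hr)
    refine ⟨density_le_density hg hν he' h1 h2 h0 h3, density_le_density hg hμ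
      (he'.neg.congr_of_eventuallyEq (.of_forall fun s => ?_)) ?_ ?_ ?_ ?_⟩
    · simp
    · rwa [abs_sub_comm]
    · rwa [abs_mul, abs_sub_comm, ← abs_mul]
    · rwa [abs_neg]
    · rwa [abs_mul, abs_sub_comm, add_comm, ← abs_mul]
  have key : ∀ μ₁ μ₂ ν₁ ν₂ : ℝ → ℝ,
      (∀ r, 0 < r → density μ₁ f r ≤ densityConst N * density ν₁ f r) →
      (∀ r, 0 < r → density μ₂ g r ≤ densityConst N * density ν₂ g r) →
      fieldEnergy μ₁ μ₂ f g ≤ .ofReal (densityConst N) * fieldEnergy ν₁ ν₂ f g := by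
    intro μ₁ μ₂ ν₁ ν₂ h1 h2
    unfold fieldEnergy
    rw [← lintegral_const_mul' _ _ ENNReal.ofReal_ne_top]
    refine lintegral_mono_ae ?_
    filter_upwards [ae_restrict_mem measurableSet_Ioi] with r hr
    rw [← ENNReal.ofReal_mul (densityConst_nonneg N), ← mul_assoc]
    refine ENNReal.ofReal_le_ofReal (mul_le_mul_of_nonneg_right ?_ (Real.sinh_pos_iff.2 hr).le)
    rw [mul_add]
    exact add_le_add (h1 r hr) (h2 r hr)
  exact ⟨key _ _ _ _ (fun r hr => (e1 r hr).1) fun r hr => (e2 r hr).1,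
    key _ _ _ _ (fun r hr => (e1 r hr).2) fun r hr => (e2 r hr).2⟩

end FieldTriple

end FieldEstimates

/-! ### The two norms as integrals of densities -/

section Norms

theorem Reg.hasDerivAt_deriv {E : Type*} [NormedAddCommGroup E] [NormedSpace ℝ E] {n : ℕ}
    {f : ℝ → E} (hf : Reg (n + 1) f) : ∀ s, 0 < s → HasDerivAt f (deriv f s) s := by
  obtain ⟨f', h, -⟩ := hf
  exact fun s hs => (h s hs).differentiableAt.hasDerivAt

theorem Reg.deriv {E : Type*} [NormedAddCommGroup E] [NormedSpace ℝ E] {n : ℕ}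
    {f : ℝ → E} (hf : Reg (n + 1) f) : Reg n (deriv f) := by
  obtain ⟨f', h, hf'⟩ := hf
  exact hf'.congr fun r hr => (h r hr).deriv.symm

theorem Reg.aemeasurable {n : ℕ} {E : Type*} [NormedAddCommGroup E] [NormedSpace ℝ E]
    [MeasurableSpace E] [BorelSpace E] {f : ℝ → E} (hf : Reg n f) :
    AEMeasurable f (volume.restrict (Ioi 0)) :=
  hf.lac.continuousOn.aemeasurable measurableSet_Ioi

theorem sqIntegral_eq_radial {E : Type*} [NormedAddCommGroup E] [NormedSpace ℝ E] {n : ℕ}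
    {T : (Fin n → Fin 2) → ℝ → ℝ → E} {Φ : (Fin n → Fin 2) → ℝ → ℂ}
    (h : ∀ᵐ r ∂volume.restrict (Ioi (0 : ℝ)), ∀ I θ, ‖T I r θ‖ = ‖Φ I r‖) :
    sqIntegral T = ENNReal.ofReal (2 * Real.pi)
      * ∫⁻ r in Ioi (0 : ℝ), ENNReal.ofReal ((∑ I, ‖Φ I r‖ ^ 2) * Real.sinh r) := by
  rw [sqIntegral, ← lintegral_const_mul' _ _ ENNReal.ofReal_ne_top]
  refine lintegral_congr_ae ?_
  filter_upwards [h] with r hr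
  simp only [hr]
  rw [lintegral_const, Measure.restrict_apply MeasurableSet.univ, univ_inter, Real.volume_Ioc,
    sub_zero, mul_comm]

theorem aemeasurable_energyDensity {n : ℕ} {Φ : (Fin n → Fin 2) → ℝ → ℂ} {μ : Measure ℝ}
    (h : ∀ I, AEMeasurable (Φ I) μ) :
    AEMeasurable (fun r => ENNReal.ofReal ((∑ I, ‖Φ I r‖ ^ 2) * Real.sinh r)) μ :=
  ((Finset.aemeasurable_fun_sum _ fun I _ => (h I).norm.pow_const 2).mul
    Real.continuous_sinh.measurable.aemeasurable).ennreal_ofReal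

theorem lintegral_energyDensity_add {n m k : ℕ} {Φ : (Fin n → Fin 2) → ℝ → ℂ}
    {Ψ : (Fin m → Fin 2) → ℝ → ℂ} {Ξ : (Fin k → Fin 2) → ℝ → ℂ}
    (hΦ : ∀ I, AEMeasurable (Φ I) (volume.restrict (Ioi (0 : ℝ))))
    (hΨ : ∀ I, AEMeasurable (Ψ I) (volume.restrict (Ioi (0 : ℝ)))) {S : ℝ → ℝ}
    (hS : ∀ᵐ r ∂volume.restrict (Ioi (0 : ℝ)),
      ∑ I, ‖Φ I r‖ ^ 2 + ∑ I, ‖Ψ I r‖ ^ 2 + ∑ I, ‖Ξ I r‖ ^ 2 = S r) :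
    (∫⁻ r in Ioi (0 : ℝ), ENNReal.ofReal ((∑ I, ‖Φ I r‖ ^ 2) * Real.sinh r))
      + (∫⁻ r in Ioi (0 : ℝ), ENNReal.ofReal ((∑ I, ‖Ψ I r‖ ^ 2) * Real.sinh r))
      + (∫⁻ r in Ioi (0 : ℝ), ENNReal.ofReal ((∑ I, ‖Ξ I r‖ ^ 2) * Real.sinh r))
      = ∫⁻ r in Ioi (0 : ℝ), ENNReal.ofReal (S r * Real.sinh r) := by
  have hΦΨ : AEMeasurable (fun r => ENNReal.ofReal ((∑ I, ‖Φ I r‖ ^ 2) * Real.sinh r)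
      + ENNReal.ofReal ((∑ I, ‖Ψ I r‖ ^ 2) * Real.sinh r)) (volume.restrict (Ioi (0 : ℝ))) :=
    (aemeasurable_energyDensity hΦ).add (aemeasurable_energyDensity hΨ)
  rw [← lintegral_add_left' (aemeasurable_energyDensity hΦ), ← lintegral_add_left' hΦΨ]
  refine lintegral_congr_ae ?_
  filter_upwards [hS, ae_restrict_mem measurableSet_Ioi] with r hr hr0
  have hs := (Real.sinh_pos_iff.2 hr0).le
  rw [← ENNReal.ofReal_add (by positivity) (by positivity),
    ← ENNReal.ofReal_add (by positivity) (by positivity), ← add_mul, ← add_mul, hr]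

theorem sobolevNorm_two_eq {F : ℝ → ℝ → ℂ} {ψ : ℝ → ℂ} {m : ℝ}
    (hF : ∀ r θ, 0 < r → F r θ = Complex.exp (m * Complex.I * (θ : ℂ)) * ψ r)
    (hψ : Reg 1 ψ) (hreg : ∀ θ, SobolevLoc 2 (fun r => F r θ)) :
    sobolevNorm 2 F = (ENNReal.ofReal (2 * Real.pi) * ∫⁻ r in Ioi (0 : ℝ),
      ENNReal.ofReal (density (fun s => csch s * m) ψ r * Real.sinh r)) ^ (1 / 2 : ℝ) := by
  have hT : ∀ l : ℕ, ∀ (I : Fin l → Fin 2) (r θ : ℝ), 0 < r →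
      iterCov F l I r θ = Complex.exp (m * Complex.I * (θ : ℂ)) * funR m ψ l I r := by
    intro l
    induction l with
    | zero => exact fun I r θ hr => hF r θ hr
    | succ l ih => exact fun I r θ hr => covDeriv_exp_mul ih I r θ hr
  have hm : ∀ l : ℕ, ∀ I : Fin l → Fin 2,
      AEMeasurable (funR m ψ l I) (volume.restrict (Ioi 0)) := by
    intro l
    induction l with
    | zero => exact fun _ => hψ.aemeasurable
    | succ l ih => exact fun I => aemeasurable_radCov aemeasurable_const ih I
  have hI : ∀ l : ℕ, sqIntegral (iterCov F l) = ENNReal.ofReal (2 * Real.pi)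
      * ∫⁻ r in Ioi (0 : ℝ), ENNReal.ofReal ((∑ I, ‖funR m ψ l I r‖ ^ 2) * Real.sinh r) := by
    intro l
    refine sqIntegral_eq_radial ?_
    filter_upwards [ae_restrict_mem measurableSet_Ioi] with r hr I θ
    have e : (m * Complex.I * (θ : ℂ)) = ((m * θ : ℝ) : ℂ) * Complex.I := by push_cast; ring
    rw [hT l I r θ hr, norm_mul, e, Complex.norm_exp_ofReal_mul_I, one_mul]
  rw [sobolevNorm, if_pos hreg]
  simp only [Finset.sum_range_succ, Finset.sum_range_zero, zero_add, hI]
  rw [← mul_add, ← mul_add, lintegral_energyDensity_add (hm 0) (hm 1)]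
  filter_upwards with r
  rw [sum_funR_zero, sum_funR_one, sum_funR_two, density]

variable {u : Hyp → S2} {v : ℝ → E3}

/-- Here `A` is the profile of `ψ₁` and `B` is `csch` times that of `i ψ₂`, so that `A ± B` are the
profiles of `ψ^±`. The second derivatives of the fields exist only almost everywhere, which suffices
under the integral. -/
theorem mapNorm_three_eq (hu : Equivariant u) (hv : IsCoulombFrame u v)
    (h : Reg 2 (profile u)) :
    mapNorm 3 u = (ENNReal.ofReal Real.pi * fieldEnergy
      (fun s => csch s * profile u s 2 + coth s) (fun s => csch s * profile u s 2 - coth s)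
      (plusR u v) (minusR u v)) ^ (1 / 2 : ℝ) := by
  have hf := frameEquations hu hv h.of_succ
  obtain ⟨hp, hm⟩ := reg_psi_of_reg_profile hu hv h
  set A := psiR u v
  set B : ℝ → ℂ := fun r => (csch r : ℂ) * zetaR u v r
  have hAr : Reg 1 A := by
    refine ((Reg.const 1 (1 / 2 : ℂ)).mul (hp.add hm)).congr fun r _ => ?_
    rw [plusR, minusR]; ring
  have hBr : Reg 1 B := by
    refine ((Reg.const 1 (1 / 2 : ℂ)).mul (hp.add hm.neg)).congr fun r _ => ?_
    rw [plusR, minusR]; simp only [B, csch]; ring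
  have hplus : plusR u v = fun s => A s + B s := rfl
  have hminus : minusR u v = fun s => A s - B s := rfl
  have hdu : duR u v = oneForm A B := rfl
  set κ : ℝ → ℝ := fun s => profile u s 2
  have hκ : Reg 2 κ := h.coord 2
  have hA : ∀ s, 0 < s → DifferentiableAt ℝ A s :=
    fun s hs => (hAr.hasDerivAt_deriv s hs).differentiableAt
  have hB : ∀ s, 0 < s → DifferentiableAt ℝ B s :=
    fun s hs => (hBr.hasDerivAt_deriv s hs).differentiableAt
  have hκd : ∀ s, 0 < s → DifferentiableAt ℝ κ s :=
    fun s hs => (hκ.hasDerivAt_deriv s hs).differentiableAt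
  have m0 : ∀ I, AEMeasurable (oneForm A B I) (volume.restrict (Ioi 0)) := by
    intro I
    unfold oneForm
    split_ifs
    · exact hAr.aemeasurable
    · exact aemeasurable_const.mul hBr.aemeasurable
  have m1 : ∀ I, AEMeasurable (radCov κ (oneForm A B) I) (volume.restrict (Ioi 0)) :=
    fun I => aemeasurable_radCov hκ.aemeasurable m0 I
  have hd : ∀ᵐ r ∂volume.restrict (Ioi (0 : ℝ)),
      DifferentiableAt ℝ (deriv A) r ∧ DifferentiableAt ℝ (deriv B) r := by
    filter_upwards [hAr.deriv.lac.ae_differentiableAt, hBr.deriv.lac.ae_differentiableAt]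
      with r h1 h2 using ⟨h1, h2⟩
  have t0 : ∀ I s θ, 0 < s → iterCovMap (inPolar u) 0 I s θ = lift u v (oneForm A B I s) s θ :=
    fun I s θ hs => by rw [← hdu]; exact iterCovMap_zero_eq_lift hu hv hf I s θ hs
  have d0 : ∀ I s, 0 < s → DifferentiableAt ℝ (oneForm A B I) s := by
    intro I s hs
    unfold oneForm
    split_ifs
    · exact hA s hs
    · exact (hB s hs).const_mul _
  have t1 : ∀ I s θ, 0 < s →
      iterCovMap (inPolar u) 1 I s θ = lift u v (radCov κ (oneForm A B) I s) s θ :=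
    fun I s θ hs => tangentProj_covDeriv hu hv hf t0 hs (fun J => d0 J s hs) I θ
  have d1 : ∀ r, 0 < r → DifferentiableAt ℝ (deriv A) r → DifferentiableAt ℝ (deriv B) r →
      ∀ I, DifferentiableAt ℝ (radCov κ (oneForm A B) I) r := by
    intro r hr hA' hB' I
    have hs : DifferentiableAt ℝ (fun s => (csch s : ℂ)) r :=
      (hasDerivAt_csch hr).ofReal_comp.differentiableAt
    have hc : DifferentiableAt ℝ (fun s => (coth s : ℂ)) r :=
      (hasDerivAt_coth hr).ofReal_comp.differentiableAt
    have hk : DifferentiableAt ℝ (fun s => ((csch s * κ s : ℝ) : ℂ)) r :=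
      ((hasDerivAt_csch hr).mul (hκd r hr).hasDerivAt).ofReal_comp.differentiableAt
    have hI : I = ![I 0, I 1] := by funext a; fin_cases a <;> rfl
    rw [hI]
    generalize I 0 = i
    generalize I 1 = j
    fin_cases i <;> fin_cases j
    · exact hA'.congr_of_eventuallyEq
        (.of_forall fun s => radCov_oneForm_zero_zero κ A B s)
    · exact (hB'.const_mul (-Complex.I)).congr_of_eventuallyEq
        (.of_forall fun s => radCov_oneForm_zero_one κ A B s)
    · exact (((hk.mul (hA r hr)).add (hc.mul (hB r hr))).const_mul Complex.I).congr_of_eventuallyEq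
        (.of_forall fun s => radCov_oneForm_one_zero κ A B s)
    · exact ((hk.mul (hB r hr)).add (hc.mul (hA r hr))).congr_of_eventuallyEq
        (.of_forall fun s => radCov_oneForm_one_one κ A B s)
  have s0 : sqIntegral (iterCovMap (inPolar u) 0) = ENNReal.ofReal (2 * Real.pi)
      * ∫⁻ r in Ioi (0 : ℝ), ENNReal.ofReal ((∑ I, ‖oneForm A B I r‖ ^ 2) * Real.sinh r) := by
    refine sqIntegral_eq_radial ?_
    filter_upwards [ae_restrict_mem measurableSet_Ioi] with r hr I θ
    rw [t0 I r θ hr, norm_lift hu hv hr]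
  have s1 : sqIntegral (iterCovMap (inPolar u) 1) = ENNReal.ofReal (2 * Real.pi)
      * ∫⁻ r in Ioi (0 : ℝ),
        ENNReal.ofReal ((∑ I, ‖radCov κ (oneForm A B) I r‖ ^ 2) * Real.sinh r) := by
    refine sqIntegral_eq_radial ?_
    filter_upwards [ae_restrict_mem measurableSet_Ioi] with r hr I θ
    rw [t1 I r θ hr, norm_lift hu hv hr]
  have s2 : sqIntegral (iterCovMap (inPolar u) 2) = ENNReal.ofReal (2 * Real.pi)
      * ∫⁻ r in Ioi (0 : ℝ),
        ENNReal.ofReal ((∑ I, ‖radCov κ (radCov κ (oneForm A B)) I r‖ ^ 2) * Real.sinh r) := by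
    refine sqIntegral_eq_radial ?_
    filter_upwards [ae_restrict_mem measurableSet_Ioi, hd] with r hr hr2 I θ
    have := tangentProj_covDeriv hu hv hf t1 hr (d1 r hr hr2.1 hr2.2) I θ
    rw [show iterCovMap (inPolar u) 2 I r θ = _ from this, norm_lift hu hv hr]
  have hreg : ∀ θ, SobolevLoc 3 (fun r => inPolar u r θ) :=
    (forall_sobolevLoc_inPolar_iff hu 2).2 h
  rw [mapNorm, if_pos hreg]
  simp only [Finset.sum_range_succ, Finset.sum_range_zero, zero_add, s0, s1, s2]
  congr 1
  rw [← mul_add, ← mul_add, lintegral_energyDensity_add m0 m1 (S := fun r => 1 / 2 *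
    (density (fun s => csch s * κ s + coth s) (plusR u v) r
      + density (fun s => csch s * κ s - coth s) (minusR u v) r))]
  -- The one half of the parallelogram identity turns the angular length `2π` into `π`.
  · simp only [mul_assoc (1 / 2 : ℝ), ENNReal.ofReal_mul (by norm_num : (0 : ℝ) ≤ 1 / 2)]
    rw [lintegral_const_mul' _ _ ENNReal.ofReal_ne_top, ← mul_assoc,
      ← ENNReal.ofReal_mul (by positivity), fieldEnergy]
    congr 2
    ring
  · filter_upwards [ae_restrict_mem measurableSet_Ioi, hd] with r hr hr2
    rw [sum_oneForm, sum_radCov_oneForm κ (hA r hr) (hB r hr),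
      sum_radCov_radCov_oneForm hr hA hB hr2.1 hr2.2 (hκd r hr), density, density, hplus, hminus]
    ring

/-- Writing `ψ^± = p ± z`, the third components of `v̄` and `w̄` are `sinh` times the real and
imaginary parts of `z`. So `κ'` is `sinh` times the real inner product of `p` and `z`, which is at
most `(|p|² + |z|²) / 2 = (|ψ⁺|² + |ψ⁻|²) / 4`. -/
theorem fieldTriple (hu : Equivariant u) (hE : ClassE0 u) (hv : IsCoulombFrame u v)
    (h : Reg 2 (profile u)) :
    FieldTriple (plusR u v) (minusR u v) (fun s => profile u s 2)
      (fun s => (psiR u v s).re * v s 2 + (psiR u v s).im * wBar u v s 2) := by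
  have hf := frameEquations hu hv h.of_succ
  obtain ⟨hp, hm⟩ := reg_psi_of_reg_profile hu hv h
  refine ⟨hp.hasDerivAt_deriv, hp.deriv.lac.continuousOn, hm.hasDerivAt_deriv,
    hm.deriv.lac.continuousOn, fun s hs => ?_, ?_, fun s _ => ?_, fun s hs => ?_⟩
  · have h1 : HasDerivAt (fun t => (EuclideanSpace.proj 2 : E3 →L[ℝ] ℝ) (profile u t))
        ((EuclideanSpace.proj 2 : E3 →L[ℝ] ℝ)
          ((psiR u v s).re • v s + (psiR u v s).im • wBar u v s)) s :=
      (EuclideanSpace.proj 2 : E3 →L[ℝ] ℝ).hasFDerivAt.comp_hasDerivAt s (hf.deriv_profile s hs)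
    simpa using h1
  · have h1 : Tendsto (fun s : ℝ => (s, (0 : ℝ))) (𝓝[>] 0) (𝓝[>] 0 ×ˢ ⊤) :=
      tendsto_id.prodMk tendsto_top
    have h2 := hE.tendsto_zero.comp h1
    simpa only [Function.comp_def, profile] using h2
  · have := inner_profile_self u s
    rw [inner_E3] at this
    nlinarith [sq_nonneg (profile u s 0), sq_nonneg (profile u s 1)]
  · have hsh := Real.sinh_pos_iff.2 hs
    set p := psiR u v s
    set z : ℂ := ((Real.sinh s)⁻¹ : ℝ) * zetaR u v s
    have e1 : plusR u v s = p + z := rfl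
    have e2 : minusR u v s = p - z := rfl
    have z1 : v s 2 = Real.sinh s * z.re := by
      have : (zetaR u v s).re = v s 2 := by simp [zetaR]
      rw [Complex.re_ofReal_mul, this, mul_inv_cancel_left₀ hsh.ne']
    have z2 : wBar u v s 2 = Real.sinh s * z.im := by
      have : (zetaR u v s).im = wBar u v s 2 := by simp [zetaR]
      rw [Complex.im_ofReal_mul, this, mul_inv_cancel_left₀ hsh.ne']
    have e3 : ‖p + z‖ ^ 2 + ‖p - z‖ ^ 2 = 2 * (p.re ^ 2 + p.im ^ 2 + z.re ^ 2 + z.im ^ 2) := by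
      simp only [← Complex.normSq_eq_norm_sq, Complex.normSq_apply, Complex.add_re,
        Complex.add_im, Complex.sub_re, Complex.sub_im]
      ring
    rw [e1, e2, e3, z1, z2]
    have e4 : p.re * (Real.sinh s * z.re) + p.im * (Real.sinh s * z.im)
        = Real.sinh s * (p.re * z.re + p.im * z.im) := by ring
    rw [e4, abs_mul, abs_of_pos hsh, mul_div_assoc]
    refine mul_le_mul_of_nonneg_left ?_ hsh.le
    rw [abs_le]
    constructor <;> nlinarith [sq_nonneg (p.re - z.re), sq_nonneg (p.im - z.im),
      sq_nonneg (p.re + z.re), sq_nonneg (p.im + z.im)]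

end Norms

/-! ### Finiteness and the polynomial bounds -/

section Main

variable {u : Hyp → S2} {v : ℝ → E3}

theorem reg_profile_of_mapNorm_lt_top (hu : Equivariant u) (h : mapNorm 3 u < ⊤) :
    Reg 2 (profile u) := by
  rw [← forall_sobolevLoc_inPolar_iff hu]
  by_contra hc
  rw [mapNorm, if_neg hc] at h
  exact lt_irrefl _ h

theorem ClassE0.lac_profile (hu : Equivariant u) (hE : ClassE0 u) : LAC (profile u) := by
  have h := hE.energy_lt_top
  rw [← show Reg 0 (profile u) ↔ LAC (profile u) from Iff.rfl, ← forall_sobolevLoc_inPolar_iff hu]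
  by_contra hc
  rw [energy, if_neg hc] at h
  exact lt_irrefl _ h

theorem reg_profile_of_fieldNorm_lt_top (hu : Equivariant u) (hE : ClassE0 u)
    (hv : IsCoulombFrame u v) (h : fieldNorm u v < ⊤) : Reg 2 (profile u) := by
  rw [fieldNorm, ENNReal.add_lt_top] at h
  refine reg_profile_of_reg_psi hu hv (hE.lac_profile hu) ?_ ?_
  · rw [← forall_sobolevLoc_RPlus_iff hu hv]
    by_contra hc
    have h1 := h.1
    rw [sobolevNorm, if_neg hc] at h1
    exact lt_irrefl _ h1
  · rw [← forall_sobolevLoc_RMinus_iff hu hv]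
    by_contra hc
    have h2 := h.2
    rw [sobolevNorm, if_neg hc] at h2
    exact lt_irrefl _ h2

theorem fieldNorm_eq (hu : Equivariant u) (hv : IsCoulombFrame u v) (h : Reg 2 (profile u)) :
    ∃ a b : ℝ≥0∞, a + b = ENNReal.ofReal (2 * Real.pi)
        * fieldEnergy (fun s => csch s * 2) (fun s => csch s * 0) (plusR u v) (minusR u v) ∧
      fieldNorm u v = a ^ (1 / 2 : ℝ) + b ^ (1 / 2 : ℝ) := by
  obtain ⟨hp, hm⟩ := reg_psi_of_reg_profile hu hv h
  have e1 := sobolevNorm_two_eq (F := RPlus (psiPlus u v)) (ψ := plusR u v) (m := 2)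
    (fun r θ hr => by
      rw [RPlus, psiPlus_eq_plusR hu hv hr]; norm_num)
    hp ((forall_sobolevLoc_RPlus_iff hu hv).2 hp)
  have e2 := sobolevNorm_two_eq (F := RMinus (psiMinus u v)) (ψ := minusR u v) (m := 0)
    (fun r θ hr => by
      rw [RMinus, psiMinus_eq_minusR hu hv hr]; simp)
    hm ((forall_sobolevLoc_RMinus_iff hu hv).2 hm)
  refine ⟨_, _, ?_, by rw [fieldNorm, e1, e2]⟩
  rw [← mul_add, fieldEnergy, ← lintegral_add_left']
  · congr 1
    refine setLIntegral_congr_fun measurableSet_Ioi fun r hr => ?_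
    have hs := (Real.sinh_pos_iff.2 hr).le
    rw [← ENNReal.ofReal_add (mul_nonneg (density_nonneg _ _ _) hs)
      (mul_nonneg (density_nonneg _ _ _) hs), ← add_mul]
  · have hsum : (fun r => ENNReal.ofReal
        (density (fun s => csch s * 2) (plusR u v) r * Real.sinh r))
        = fun r => ENNReal.ofReal ((∑ I, ‖funR 2 (plusR u v) 0 I r‖ ^ 2
          + ∑ I, ‖funR 2 (plusR u v) 1 I r‖ ^ 2
          + ∑ I, ‖funR 2 (plusR u v) 2 I r‖ ^ 2) * Real.sinh r) := by
      funext r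
      rw [sum_funR_zero, sum_funR_one, sum_funR_two, density]
    rw [hsum]
    have hl : ∀ l : ℕ, ∀ I : Fin l → Fin 2,
        AEMeasurable (funR 2 (plusR u v) l I) (volume.restrict (Ioi 0)) := by
      intro l
      induction l with
      | zero => exact fun _ => hp.aemeasurable
      | succ l ih => exact fun I => aemeasurable_radCov aemeasurable_const ih I
    have hs : ∀ l : ℕ, AEMeasurable (fun r => ∑ I, ‖funR 2 (plusR u v) l I r‖ ^ 2)
        (volume.restrict (Ioi 0)) :=
      fun l => Finset.aemeasurable_fun_sum _ fun I _ => (hl l I).norm.pow_const 2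
    exact ((((hs 0).add (hs 1)).add (hs 2)).mul
      Real.continuous_sinh.measurable.aemeasurable).ennreal_ofReal

open Polynomial in
/-- The polynomial of the norm comparison. -/
noncomputable def normPoly : ℝ[X] :=
  2 * X * (3 + 10 * ((X ^ 2 * (1 + (1 + X ^ 2) ^ 4) + 3) ^ 2) ^ 2)

theorem normPoly_eval (x : ℝ) : normPoly.eval x = 2 * x * densityConst (x ^ 2) := by
  simp [normPoly, densityConst, FieldTriple.heightBound]

/-- As `densityConst ≥ 1`, it is at most its own square, so the square root of the bound is
dominated by a polynomial. -/
theorem le_normPoly_of_sq_le {x y : ℝ} (hy : 0 ≤ y)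
    (h : x ^ 2 ≤ 4 * densityConst (y ^ 2) * y ^ 2) : x ≤ normPoly.eval y := by
  have hG : 1 ≤ densityConst (y ^ 2) := by
    unfold densityConst
    have : 0 ≤ ((FieldTriple.heightBound (y ^ 2) + 3) ^ 2) ^ 2 := by positivity
    linarith
  rw [normPoly_eval]
  refine le_of_sq_le_sq (h.trans ?_) (by positivity)
  have : 0 ≤ y ^ 2 * (densityConst (y ^ 2) * (densityConst (y ^ 2) - 1)) := by
    have : 0 ≤ densityConst (y ^ 2) - 1 := by linarith
    positivity
  nlinarith

theorem ofReal_mul_lt_top_iff {p : ℝ} (hp : 0 < p) (J : ℝ≥0∞) :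
    ENNReal.ofReal p * J < ⊤ ↔ J < ⊤ :=
  ⟨fun h => ENNReal.lt_top_of_mul_ne_top_right h.ne (by simpa using hp),
    ENNReal.mul_lt_top ENNReal.ofReal_lt_top⟩

/-- Finiteness passes across by taking `N` to be the finite energy itself. For the bounds, `N` is
the square of the norm on the right-hand side; it dominates the corresponding energy because `π ≥
1`. -/
theorem norms_comparable {J K a b : ℝ≥0∞} (hab : a + b = ENNReal.ofReal (2 * Real.pi) * K)
    (hJK : ∀ N : ℝ, 0 ≤ N → J ≤ .ofReal N ∨ K ≤ .ofReal N →
      J ≤ .ofReal (densityConst N) * K ∧ K ≤ .ofReal (densityConst N) * J) :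
    ((ENNReal.ofReal Real.pi * J) ^ (1 / 2 : ℝ) < ⊤ ↔
      a ^ (1 / 2 : ℝ) + b ^ (1 / 2 : ℝ) < ⊤) ∧
    ((ENNReal.ofReal Real.pi * J) ^ (1 / 2 : ℝ) < ⊤ →
      ((ENNReal.ofReal Real.pi * J) ^ (1 / 2 : ℝ)).toReal
        ≤ normPoly.eval (a ^ (1 / 2 : ℝ) + b ^ (1 / 2 : ℝ)).toReal ∧
      (a ^ (1 / 2 : ℝ) + b ^ (1 / 2 : ℝ)).toReal
        ≤ normPoly.eval ((ENNReal.ofReal Real.pi * J) ^ (1 / 2 : ℝ)).toReal) := by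
  have hpi := Real.pi_pos
  have hhalf : (0 : ℝ) < 1 / 2 := by norm_num
  have f1 : (ENNReal.ofReal Real.pi * J) ^ (1 / 2 : ℝ) < ⊤ ↔ J < ⊤ := by
    rw [ENNReal.rpow_lt_top_iff_of_pos hhalf, ofReal_mul_lt_top_iff hpi]
  have f2 : a ^ (1 / 2 : ℝ) + b ^ (1 / 2 : ℝ) < ⊤ ↔ K < ⊤ := by
    rw [ENNReal.add_lt_top, ENNReal.rpow_lt_top_iff_of_pos hhalf,
      ENNReal.rpow_lt_top_iff_of_pos hhalf, ← ENNReal.add_lt_top, hab,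
      ofReal_mul_lt_top_iff (by positivity)]
  have f3 : J < ⊤ ↔ K < ⊤ := by
    constructor
    · intro h
      exact (hJK J.toReal ENNReal.toReal_nonneg
        (Or.inl (ENNReal.ofReal_toReal h.ne).ge)).2.trans_lt
        (ENNReal.mul_lt_top ENNReal.ofReal_lt_top h)
    · intro h
      exact (hJK K.toReal ENNReal.toReal_nonneg
        (Or.inr (ENNReal.ofReal_toReal h.ne).ge)).1.trans_lt
        (ENNReal.mul_lt_top ENNReal.ofReal_lt_top h)
  refine ⟨by rw [f1, f2, f3], fun h => ?_⟩
  have hJ := f1.1 h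
  have hK := f3.1 hJ
  have hab' : a + b < ⊤ := by
    rw [hab]; exact ENNReal.mul_lt_top ENNReal.ofReal_lt_top hK
  obtain ⟨ha, hb⟩ := ENNReal.add_lt_top.1 hab'
  have hsum : a.toReal + b.toReal = 2 * Real.pi * K.toReal := by
    rw [← ENNReal.toReal_add ha.ne hb.ne, hab, ENNReal.toReal_mul,
      ENNReal.toReal_ofReal (by positivity)]
  have hx : ((ENNReal.ofReal Real.pi * J) ^ (1 / 2 : ℝ)).toReal ^ 2 = Real.pi * J.toReal := by
    rw [← ENNReal.toReal_rpow, ← Real.sqrt_eq_rpow, Real.sq_sqrt ENNReal.toReal_nonneg,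
      ENNReal.toReal_mul, ENNReal.toReal_ofReal hpi.le]
  have hy : (a ^ (1 / 2 : ℝ) + b ^ (1 / 2 : ℝ)).toReal = √a.toReal + √b.toReal := by
    rw [ENNReal.toReal_add (ENNReal.rpow_lt_top_of_nonneg hhalf.le ha.ne).ne
      (ENNReal.rpow_lt_top_of_nonneg hhalf.le hb.ne).ne, ← ENNReal.toReal_rpow,
      ← ENNReal.toReal_rpow, Real.sqrt_eq_rpow, Real.sqrt_eq_rpow]
  set x := ((ENNReal.ofReal Real.pi * J) ^ (1 / 2 : ℝ)).toReal
  set y := (a ^ (1 / 2 : ℝ) + b ^ (1 / 2 : ℝ)).toReal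
  have hx0 : 0 ≤ x := ENNReal.toReal_nonneg
  have hy0 : 0 ≤ y := ENNReal.toReal_nonneg
  have sa := Real.sq_sqrt (ENNReal.toReal_nonneg (a := a))
  have sb := Real.sq_sqrt (ENNReal.toReal_nonneg (a := b))
  have na := Real.sqrt_nonneg a.toReal
  have nb := Real.sqrt_nonneg b.toReal
  have hy1 : 2 * Real.pi * K.toReal ≤ y ^ 2 := by
    rw [hy, ← hsum]; nlinarith [mul_nonneg na nb]
  -- The square of a sum of two norms is at most twice the sum of their squares; this is the source
  -- of the factor `4` in `le_normPoly_of_sq_le`.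
  have hy2 : y ^ 2 ≤ 4 * Real.pi * K.toReal := by
    rw [hy]; nlinarith [sq_nonneg (√a.toReal - √b.toReal)]
  have hJ0 : 0 ≤ J.toReal := ENNReal.toReal_nonneg
  have hK0 : 0 ≤ K.toReal := ENNReal.toReal_nonneg
  have hpi1 : 1 ≤ Real.pi := by linarith [Real.pi_gt_three]
  have cmp : ∀ N, J ≤ .ofReal N ∨ K ≤ .ofReal N → 0 ≤ N →
      J.toReal ≤ densityConst N * K.toReal ∧ K.toReal ≤ densityConst N * J.toReal := by
    intro N h hN
    obtain ⟨h1, h2⟩ := hJK N hN h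
    have hc := densityConst_nonneg N
    constructor
    · have := ENNReal.toReal_mono (ENNReal.mul_lt_top ENNReal.ofReal_lt_top hK).ne h1
      rwa [ENNReal.toReal_mul, ENNReal.toReal_ofReal hc] at this
    · have := ENNReal.toReal_mono (ENNReal.mul_lt_top ENNReal.ofReal_lt_top hJ).ne h2
      rwa [ENNReal.toReal_mul, ENNReal.toReal_ofReal hc] at this
  constructor
  · refine le_normPoly_of_sq_le hy0 ?_
    have hN : K ≤ .ofReal (y ^ 2) := by
      rw [← ENNReal.ofReal_toReal hK.ne]
      exact ENNReal.ofReal_le_ofReal (by nlinarith)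
    have h1 := (cmp _ (Or.inr hN) (by positivity)).1
    have hc := densityConst_nonneg (y ^ 2)
    have h2 := mul_le_mul_of_nonneg_left hy1 hc
    have h3 := mul_le_mul_of_nonneg_left h1 hpi.le
    have h4 : 0 ≤ densityConst (y ^ 2) * y ^ 2 := by positivity
    rw [hx]; linarith
  · refine le_normPoly_of_sq_le hx0 ?_
    have hN : J ≤ .ofReal (x ^ 2) := by
      rw [← ENNReal.ofReal_toReal hJ.ne]
      exact ENNReal.ofReal_le_ofReal (by nlinarith)
    have h1 := (cmp _ (Or.inl hN) (by positivity)).2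
    have h3 := mul_le_mul_of_nonneg_left h1 hpi.le
    have h5 : densityConst (x ^ 2) * x ^ 2 = densityConst (x ^ 2) * (Real.pi * J.toReal) := by
      rw [hx]
    linarith

end Main

end HypMap

theorem mainTheorem9 :
    ∃ P Q : Polynomial ℝ, P.eval 0 = 0 ∧ Q.eval 0 = 0 ∧
      ∀ (u : HypMap.Hyp → HypMap.S2) (v : ℝ → HypMap.E3),
        HypMap.Equivariant u → HypMap.ClassE0 u → HypMap.IsCoulombFrame u v →
          (HypMap.mapNorm 3 u < ⊤ ↔ HypMap.fieldNorm u v < ⊤) ∧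
          (HypMap.mapNorm 3 u < ⊤ →
            (HypMap.mapNorm 3 u).toReal ≤ P.eval (HypMap.fieldNorm u v).toReal ∧
            (HypMap.fieldNorm u v).toReal ≤ Q.eval (HypMap.mapNorm 3 u).toReal) := by
  refine ⟨HypMap.normPoly, HypMap.normPoly, by simp [HypMap.normPoly_eval],
    by simp [HypMap.normPoly_eval], fun u v hu hE hv => ?_⟩
  -- Without this regularity both norms are infinite; with it both are given by the integral
  -- formulas.
  by_cases hreg : HypMap.Reg 2 (HypMap.profile u)
  · obtain ⟨a, b, hab, hF⟩ := HypMap.fieldNorm_eq hu hv hreg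
    rw [hF, HypMap.mapNorm_three_eq hu hv hreg]
    exact HypMap.norms_comparable hab fun N hN h =>
      (HypMap.fieldTriple hu hE hv hreg).fieldEnergy_comparable hN h
  · have h1 : ¬ HypMap.mapNorm 3 u < ⊤ :=
      fun h => hreg (HypMap.reg_profile_of_mapNorm_lt_top hu h)
    have h2 : ¬ HypMap.fieldNorm u v < ⊤ :=
      fun h => hreg (HypMap.reg_profile_of_fieldNorm_lt_top hu hE hv h)
    exact ⟨iff_of_false h1 h2, fun h => absurd h h1⟩
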